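/- **Notation.** Let $\mathbb T=\mathbb R/2\pi\mathbb Z$ and $\langle x\rangle=1+|x|$. A distribution on $\mathbb T\times\mathbb R$ is written $u(x,t)=\sum_{k\in\mathbb Z}u_k(t)e^{ikx}$, and $\widehat u(k,\tau)$ denotes its space-time Fourier transform, normalized by $u_k(t)=\int_{\mathbb R}\widehat u(k,\tau)e^{it\tau}\,d\tau$. For $s,b\in\mathbb R$ and $\delta>0$ let $$\|u\|_{X^{s,b}}=\big\|\langle k\rangle^s\langle\tau-k^3\rangle^b\,\widehat u(k,\tau)\big\|_{L^2(dk\,d\tau)},\qquad \|u\|_{X^{s,b}_\delta}=\inf\big\{\|\tilde u\|_{X^{s,b}}:\ \tilde u=u\ \text{on}\ [-\delta,\delta]\big\},$$ where $dk$ is the counting measure on $\mathbb Z$ and equality on $[-\delta,\delta]$ is meant in the sense of distributions on $\mathbb T\times(-\delta,\delta)$. For $u,v,w$ define $\mathcal R(u,v,w)=\sum_{k\neq0}\mathcal R(u,v,w)_k\,e^{ikx}$ with $$\mathcal R(u,v,w)_k=\frac i3\sum_{\substack{k_1+k_2+k_3=k,\ k_1\ne0\\(k_2+k_3)(k_1+k_2)(k_1+k_3)\neq0}}\frac{u_{k_1}v_{k_2}w_{k_3}}{k_1}.$$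 (If $u$ has mean zero in $x$, that is $u_0=0$, the restriction $k_1\neq0$ omits nothing.) **Proposition 3.4.** Let $s>-1/2$ and $s_1<\min(s+1,3s+1)$. There is $\varepsilon_0>0$, depending only on $s,s_1$, such that for every $\varepsilon\in(0,\varepsilon_0)$ there is a constant $C$, depending only on $s,s_1,\varepsilon$, with the following property. For every $\delta>0$ and all $u,v,w\in X^{s,1/2}_\delta$, the products $u_{k_1}v_{k_2}w_{k_3}$ are integrable on $(-\delta,\delta)$, for each $k\neq0$ the sum defining $\mathcal R(u,v,w)_k$ converges unconditionally when tested against any smooth function supported in $(-\delta,\delta)$, and $$\|\mathcal R(u,v,w)\|_{X_\delta^{s_1,-1/2+\varepsilon}}\le C\,\|u\|_{X_\delta^{s,1/2}}\|v\|_{X_\delta^{s,1/2}}\|w\|_{X_\delta^{s,1/2}}.$$ -/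

import Mathlib

open MeasureTheory Set
open scoped ENNReal NNReal SchwartzMap

noncomputable section

namespace PeriodicKdV

/-- The bracket `⟨x⟩ = 1 + |x|`. -/
def bracket (x : ℝ) : ℝ := 1 + |x|

/-- A distribution on `𝕋 × ℝ`, `𝕋 = ℝ / 2πℤ`, written as `∑ₖ T k (t) e^{ikx}`: its spatial Fourier
coefficients are tempered distributions in the time variable. -/
abbrev SpaceTimeDistribution := ℤ → 𝓢'(ℝ, ℂ)

/-- `F (k, τ)` is the space-time Fourier transform of `T`, that is `T k (t) = ∫ F (k, τ) e^{itτ} dτ`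
in the sense of tempered distributions in `t`. -/
def HasSpaceTimeFourier (T : SpaceTimeDistribution) (F : ℤ × ℝ → ℂ) : Prop :=
  AEStronglyMeasurable F (Measure.count.prod volume) ∧
  ∀ (k : ℤ) (φ : 𝓢(ℝ, ℂ)),
    Integrable (fun τ : ℝ => F (k, τ) * ∫ t : ℝ, Complex.exp (Complex.I * t * τ) * φ t) ∧
    T k φ = ∫ τ : ℝ, F (k, τ) * ∫ t : ℝ, Complex.exp (Complex.I * t * τ) * φ t

/-- The norm `‖⟨k⟩^s ⟨τ - k³⟩^b F(k, τ)‖` in `L²(dk dτ)`, `dk` the counting measure on `ℤ`. -/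
def weightedL2Norm (s b : ℝ) (F : ℤ × ℝ → ℂ) : ℝ≥0∞ :=
  eLpNorm
    (fun p : ℤ × ℝ =>
      ((bracket (p.1 : ℝ) ^ s * bracket (p.2 - (p.1 : ℝ) ^ 3) ^ b : ℝ) : ℂ) * F p)
    2 (Measure.count.prod volume)

/-- The norm of `X^{s,b}`. It is `∞` if the space-time Fourier transform is not a function;
otherwise that function is unique up to null sets, and the infimum is over its versions. -/
def xNorm (s b : ℝ) (T : SpaceTimeDistribution) : ℝ≥0∞ :=
  ⨅ (F : ℤ × ℝ → ℂ) (_ : HasSpaceTimeFourier T F), weightedL2Norm s b F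

/-- A test function in time, supported in the open interval `(-δ, δ)`. -/
def IsTest (δ : ℝ) (φ : 𝓢(ℝ, ℂ)) : Prop := tsupport φ ⊆ Ioo (-δ) δ

/-- The restricted norm of `X_δ^{s,b}`: the infimum of the `X^{s,b}` norms of all distributions on
`𝕋 × ℝ` that agree with `A` on the time interval. Here `A` is given by the pairings `A k φ` of its
`k`-th spatial Fourier coefficient with the test functions `φ`. -/
def restrictedNorm (δ s b : ℝ) (A : ℤ → 𝓢(ℝ, ℂ) → ℂ) : ℝ≥0∞ :=
  ⨅ (T : SpaceTimeDistribution) (_ : ∀ k φ, IsTest δ φ → T k φ = A k φ), xNorm s b T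

/-- The pairings of `u = ∑ₖ u k (t) e^{ikx}` with test functions, when each `u k` is a function. -/
def pairing (u : ℤ → ℝ → ℂ) (k : ℤ) (φ : 𝓢(ℝ, ℂ)) : ℂ := ∫ t : ℝ, u k t * φ t

/-- `u = ∑ₖ u k (t) e^{ikx}` belongs to `X_δ^{s,b}`. For `b ≥ 0` every element of that space has
this form, since its spatial Fourier coefficients are square integrable in time (for `s < 0` the
series in `x` is in general only a distribution). -/
def MemRestricted (δ s b : ℝ) (u : ℤ → ℝ → ℂ) : Prop :=
  (∀ k, LocallyIntegrableOn (u k) (Ioo (-δ) δ)) ∧ restrictedNorm δ s b (pairing u) < ⊤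

/-- The frequencies `(k₁, k₂, k₃)` of the non-resonant sum for the output frequency `k`. The
frequency `k₁ = 0`, which does not occur when `u` has mean zero, is left out. -/
def nonresonant (k : ℤ) : Set (ℤ × ℤ × ℤ) :=
  {q | q.1 + q.2.1 + q.2.2 = k ∧ (q.2.1 + q.2.2) * (q.1 + q.2.1) * (q.1 + q.2.2) ≠ 0 ∧ q.1 ≠ 0}

/-- The pairing of `u_{k₁} v_{k₂} w_{k₃} / k₁` with the test function `φ`. -/
def cubicTerm (u v w : ℤ → ℝ → ℂ) (φ : 𝓢(ℝ, ℂ)) (q : ℤ × ℤ × ℤ) : ℂ :=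
  (∫ t : ℝ, u q.1 t * v q.2.1 t * w q.2.2 t * φ t) / (q.1 : ℂ)

/-- The non-resonant cubic term `ℛ(u, v, w)` as a distribution:
`ℛ(u, v, w)_k = (i/3) ∑ u_{k₁} v_{k₂} w_{k₃} / k₁` for `k ≠ 0`, and `ℛ(u, v, w)_0 = 0`. -/
def cubicR (u v w : ℤ → ℝ → ℂ) (k : ℤ) (φ : 𝓢(ℝ, ℂ)) : ℂ :=
  if k = 0 then 0 else (Complex.I / 3) * ∑' q : nonresonant k, cubicTerm u v w φ q

end PeriodicKdV

end

/-!
The estimate is reduced to a trilinear `L²` bound on the Fourier side, where `u`, `v`, `w` are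
replaced by the absolute values of the space-time Fourier transforms `F`, `G`, `H` of extensions.

For `(k, τ) = ∑ (kⱼ, τⱼ)` the modulations satisfy the resonance identity
`τ - k³ = ∑ (τⱼ - kⱼ³) - 3 (k₁ + k₂) (k₂ + k₃) (k₁ + k₃)` (`modulation_add_add`). The product `R` of
the three sums does not vanish on the non-resonant set, so that the largest of the four modulations
is `≳ |R|`. Because of `s > -1/2` and `s₁ < min (s + 1) (3 s + 1)` the frequency multiplier
`⟨k⟩^{s₁} ⟨k₁⟩^{-s-1} ⟨k₂⟩^{-s} ⟨k₃⟩^{-s}` is `≲ |R|^{(1-η)/2}` for some `η > 0`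
(`exists_multiplier_le`), so that the weight `|R|^{-1/2+ε}` taken from the largest modulation absorbs
it with a power of `|R|` to spare (`kernel_le_sum`). In each of the four cases the remaining kernel
is square integrable in the other variables, uniformly in the variable with the largest modulation:
the integrals in time are convolutions of powers of brackets, and the sum over the frequencies is a
sum over the values of `R`, each of which is taken `O(|R|^κ)` times by the divisor bound
(`exists_tsum_phase_le`, `exists_lintegral_kernel_le`). Cauchy–Schwarz and duality give the
trilinear bound (`lintegral_sq_trilinear_le`, `exists_lintegral_sq_trilinear_le`).

To return to the functions `u`, `v`, `w` themselves, one uses that an extension of finite `X^{s,1/2}`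
norm has spatial Fourier coefficients in `L²`, which agree with those of `u` almost everywhere on the
time interval (`exists_isExtension`). The weight `⟨τ - k³⟩^{1/2}` makes a convolution of two
transforms square integrable (`memLp_conv`), so that a product of three coefficients is integrable
and its Fourier transform is a double convolution (`IsTimeTransform.mul`). The finiteness of the
trilinear expression allows the sum over the frequencies to be exchanged with the pairing in time
(`hasSum_integral_tripleConv`), which proves the convergence and shows that the sum of the double
convolutions is the Fourier transform of an extension of `ℛ(u, v, w)`
(`IsExtension.restrictedNorm_cubicR_le`). The theorem follows by letting the norms of the extensions
tend to their infima.
-/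

open MeasureTheory Set
open scoped ENNReal NNReal SchwartzMap

noncomputable section

namespace PeriodicKdV

/-! ### Decay weights and elementary sums -/

lemma one_le_bracket (x : ℝ) : 1 ≤ bracket x := by
  unfold bracket; linarith [abs_nonneg x]

lemma bracket_pos (x : ℝ) : 0 < bracket x := by linarith [one_le_bracket x]

lemma bracket_neg (x : ℝ) : bracket (-x) = bracket x := by simp [bracket]

lemma bracket_add_le (x y : ℝ) : bracket (x + y) ≤ bracket x * bracket y := by
  unfold bracket
  nlinarith [abs_nonneg x, abs_nonneg y, abs_add_le x y, mul_nonneg (abs_nonneg x) (abs_nonneg y)]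

lemma measurable_bracket : Measurable bracket := by
  unfold bracket; fun_prop

/-- The weight `⟨x⟩^{-a}` as an extended nonnegative number. -/
def decay (a x : ℝ) : ℝ≥0∞ := ENNReal.ofReal (bracket x ^ (-a))

@[fun_prop]
lemma measurable_decay (a : ℝ) : Measurable (decay a) := by
  unfold decay
  exact (measurable_bracket.pow_const _).ennreal_ofReal

lemma decay_neg (a x : ℝ) : decay a (-x) = decay a x := by simp [decay, bracket_neg]

lemma decay_sub_comm (a x y : ℝ) : decay a (x - y) = decay a (y - x) := by
  rw [← decay_neg, neg_sub]

lemma decay_anti {a b : ℝ} (h : a ≤ b) (x : ℝ) : decay b x ≤ decay a x :=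
  ENNReal.ofReal_le_ofReal (Real.rpow_le_rpow_of_exponent_le (one_le_bracket x) (by linarith))

lemma decay_ne_top (a x : ℝ) : decay a x ≠ ⊤ := ENNReal.ofReal_ne_top

lemma decay_ne_zero (a x : ℝ) : decay a x ≠ 0 := by
  unfold decay
  have := Real.rpow_pos_of_pos (bracket_pos x) (-a)
  simpa using this

lemma decay_mul (a b x : ℝ) : decay a x * decay b x = decay (a + b) x := by
  unfold decay
  rw [← ENNReal.ofReal_mul (Real.rpow_nonneg (bracket_pos x).le _),
    ← Real.rpow_add (bracket_pos x), neg_add]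

lemma decay_zero (x : ℝ) : decay 0 x = 1 := by simp [decay]

lemma lintegral_decay_lt_top {p : ℝ} (hp : 1 < p) : ∫⁻ x, decay p x < ⊤ := by
  have h : Integrable (fun x : ℝ => (1 + ‖x‖) ^ (-p)) :=
    integrable_one_add_norm (by simpa using hp)
  exact h.lintegral_lt_top

/-- The larger of `⟨x⟩`, `⟨y⟩` is comparable to at least `⟨x - y⟩`, which gives a factor
`⟨x - y⟩^{-c}` at the expense of `c` powers of it; the remaining powers pass to the smaller one. -/
lemma bracket_rpow_mul_le {a b c x y : ℝ} (h0 : 0 ≤ c) (hb : c ≤ b) (hxy : bracket x ≤ bracket y) :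
    bracket x ^ (-a) * bracket y ^ (-b) ≤
      2 ^ c * bracket (x - y) ^ (-c) * bracket x ^ (-(a + b - c)) := by
  have hx := bracket_pos x
  have hy := bracket_pos y
  have h1 : bracket (x - y) ≤ 2 * bracket y := by
    have : bracket (x - y) ≤ bracket x + bracket y := by
      unfold bracket; linarith [abs_sub x y]
    linarith
  have h2 : bracket y ^ (-c) ≤ 2 ^ c * bracket (x - y) ^ (-c) := by
    have h3 : (2 * bracket y) ^ (-c) ≤ bracket (x - y) ^ (-c) :=
      Real.rpow_le_rpow_of_nonpos (bracket_pos _) h1 (by linarith)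
    rw [Real.mul_rpow (by norm_num) hy.le, Real.rpow_neg (by norm_num : (0:ℝ) ≤ 2)] at h3
    have h4 : (0:ℝ) < 2 ^ c := by positivity
    calc bracket y ^ (-c) = 2 ^ c * ((2 ^ c)⁻¹ * bracket y ^ (-c)) := by field_simp
      _ ≤ _ := by gcongr
  have h3 : bracket y ^ (-(b - c)) ≤ bracket x ^ (-(b - c)) :=
    Real.rpow_le_rpow_of_nonpos hx hxy (by linarith)
  calc bracket x ^ (-a) * bracket y ^ (-b)
      = bracket x ^ (-a) * (bracket y ^ (-c) * bracket y ^ (-(b - c))) := by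
        rw [← Real.rpow_add hy]; ring_nf
    _ ≤ bracket x ^ (-a) * ((2 ^ c * bracket (x - y) ^ (-c)) * bracket x ^ (-(b - c))) :=
        mul_le_mul_of_nonneg_left (mul_le_mul h2 h3 (by positivity)
          (mul_nonneg (by positivity) (Real.rpow_nonneg (bracket_pos _).le _))) (by positivity)
    _ = 2 ^ c * bracket (x - y) ^ (-c) * (bracket x ^ (-a) * bracket x ^ (-(b - c))) := by ring
    _ = _ := by rw [← Real.rpow_add hx]; ring_nf

lemma decay_mul_decay_le {a b c : ℝ} (h0 : 0 ≤ c) (ha : c ≤ a) (hb : c ≤ b) (x y : ℝ) :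
    decay a x * decay b y ≤ ENNReal.ofReal (2 ^ c) * decay c (x - y) *
      (decay (a + b - c) x + decay (a + b - c) y) := by
  have key : ∀ {a b x y : ℝ}, c ≤ b → bracket x ≤ bracket y →
      decay a x * decay b y ≤
        ENNReal.ofReal (2 ^ c) * decay c (x - y) * decay (a + b - c) x := by
    intro a b x y hb hxy
    unfold decay
    rw [← ENNReal.ofReal_mul (Real.rpow_nonneg (bracket_pos x).le _),
      ← ENNReal.ofReal_mul (by positivity), ← ENNReal.ofReal_mul (mul_nonneg (by positivity)
        (Real.rpow_nonneg (bracket_pos _).le _))]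
    exact ENNReal.ofReal_le_ofReal (bracket_rpow_mul_le h0 hb hxy)
  rcases le_total (bracket x) (bracket y) with h | h
  · exact (key hb h).trans (by gcongr; exact le_self_add)
  · have := key (a := b) (b := a) ha h
    rw [mul_comm, decay_sub_comm, add_comm a b]
    exact this.trans (by gcongr; exact le_add_self)

/-- Convolving two of the weights loses slightly more than one power of the bracket, and the rest of
the decay is kept. -/
lemma exists_lintegral_decay_mul_decay_le {a b c : ℝ} (h0 : 0 ≤ c) (ha : c ≤ a) (hb : c ≤ b)
    (h : 1 < a + b - c) :
    ∃ C : ℝ≥0, ∀ y z : ℝ, ∫⁻ x, decay a (x - y) * decay b (x - z) ≤ C * decay c (y - z) := by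
  set I : ℝ≥0∞ := ∫⁻ x, decay (a + b - c) x with hI
  have hIt : I ≠ ⊤ := (lintegral_decay_lt_top h).ne
  have hne : ENNReal.ofReal (2 ^ c) * (I + I) ≠ ⊤ :=
    ENNReal.mul_ne_top ENNReal.ofReal_ne_top (ENNReal.add_ne_top.2 ⟨hIt, hIt⟩)
  refine ⟨(ENNReal.ofReal (2 ^ c) * (I + I)).toNNReal, fun y z => ?_⟩
  rw [ENNReal.coe_toNNReal hne]
  calc ∫⁻ x, decay a (x - y) * decay b (x - z)
      ≤ ∫⁻ x, ENNReal.ofReal (2 ^ c) * decay c (y - z) *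
          (decay (a + b - c) (x - y) + decay (a + b - c) (x - z)) := by
        refine lintegral_mono fun x => ?_
        have := decay_mul_decay_le h0 ha hb (x - y) (x - z)
        rwa [show x - y - (x - z) = z - y by ring, decay_sub_comm c z y] at this
    _ = ENNReal.ofReal (2 ^ c) * decay c (y - z) * (I + I) := by
        rw [lintegral_const_mul _ (by fun_prop), lintegral_add_left (by fun_prop),
          lintegral_sub_right_eq_self (fun x => decay (a + b - c) x),
          lintegral_sub_right_eq_self (fun x => decay (a + b - c) x)]
    _ = _ := by ring

/-- The divisor bound `d(n) ≲ n^κ`. Both sides are multiplicative in `n`, so that prime powers can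
be compared one at a time. -/
lemma exists_card_divisors_le_rpow {κ : ℝ} (hκ : 0 < κ) :
    ∃ C : ℝ, 0 < C ∧ ∀ n : ℕ, n ≠ 0 → (n.divisors.card : ℝ) ≤ C * (n : ℝ) ^ κ := by
  have hl : 0 < κ * Real.log 2 := mul_pos hκ (Real.log_pos (by norm_num))
  set A : ℝ := 1 + (κ * Real.log 2)⁻¹ with hA
  have hA1 : 1 ≤ A := by rw [hA]; linarith [inv_pos.2 hl]
  set N : ℕ := ⌈(2 : ℝ) ^ κ⁻¹⌉₊ with hN
  -- Only the primes below `2^{1/κ}` cost a constant.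
  have hp : ∀ p e : ℕ, p.Prime →
      ((e + 1 : ℕ) : ℝ) ≤ (if p < N then A else 1) * ((p : ℝ) ^ e) ^ κ := by
    intro p e hp
    have h2 : (2 : ℝ) ≤ p := by exact_mod_cast hp.two_le
    have hcomm : ((p : ℝ) ^ e) ^ κ = ((p : ℝ) ^ κ) ^ e := by
      rw [← Real.rpow_natCast, ← Real.rpow_mul (by positivity), mul_comm, Real.rpow_mul_natCast
        (by positivity)]
    split_ifs with hpN
    · have h3 : 1 + e * (κ * Real.log 2) ≤ ((p : ℝ) ^ e) ^ κ := by
        calc 1 + e * (κ * Real.log 2) ≤ Real.exp (e * (κ * Real.log 2)) := by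
              linarith [Real.add_one_le_exp (e * (κ * Real.log 2))]
          _ = ((2 : ℝ) ^ κ) ^ e := by
              rw [Real.rpow_def_of_pos (by norm_num), ← Real.exp_nat_mul]; ring_nf
          _ ≤ ((p : ℝ) ^ κ) ^ e := by gcongr
          _ = _ := hcomm.symm
      have h4 : ((e + 1 : ℕ) : ℝ) ≤ A * (1 + e * (κ * Real.log 2)) := by
        have he : (0 : ℝ) ≤ e := by positivity
        have : A * (1 + e * (κ * Real.log 2)) =
            1 + e * (κ * Real.log 2) + (κ * Real.log 2)⁻¹ + e := by
          rw [hA]; field_simp; ring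
        rw [this]; push_cast
        nlinarith [inv_pos.2 hl, mul_nonneg he hl.le]
      exact h4.trans (by gcongr)
    · have h3 : (2 : ℝ) ≤ (p : ℝ) ^ κ := by
        have : (2 : ℝ) ^ κ⁻¹ ≤ p := (Nat.le_ceil _).trans (by exact_mod_cast not_lt.1 hpN)
        calc (2 : ℝ) = ((2 : ℝ) ^ κ⁻¹) ^ κ := by
              rw [← Real.rpow_mul (by norm_num), inv_mul_cancel₀ hκ.ne', Real.rpow_one]
          _ ≤ _ := by gcongr
      rw [one_mul, hcomm]
      calc ((e + 1 : ℕ) : ℝ) ≤ (2 : ℝ) ^ e := by exact_mod_cast Nat.lt_two_pow_self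
        _ ≤ _ := by gcongr
  refine ⟨A ^ N, by positivity, fun n hn => ?_⟩
  rw [Nat.card_divisors hn]
  push_cast
  have hprod : (n : ℝ) ^ κ = ∏ p ∈ n.primeFactors, ((p : ℝ) ^ n.factorization p) ^ κ := by
    rw [Real.finsetProd_rpow _ _ (fun i _ => by positivity)]
    congr 1
    conv_lhs => rw [← Nat.prod_factorization_pow_eq_self hn]
    rw [Finsupp.prod, Nat.support_factorization]; push_cast; rfl
  calc ∏ p ∈ n.primeFactors, ((n.factorization p : ℝ) + 1)
      ≤ ∏ p ∈ n.primeFactors,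
          ((if p < N then A else 1) * ((p : ℝ) ^ n.factorization p) ^ κ) := by
        refine Finset.prod_le_prod (fun _ _ => by positivity) fun p hpn => ?_
        simpa using hp p (n.factorization p) (Nat.prime_of_mem_primeFactors hpn)
    _ = (∏ p ∈ n.primeFactors, (if p < N then A else 1)) * (n : ℝ) ^ κ := by
        rw [Finset.prod_mul_distrib, hprod]
    _ ≤ A ^ N * (n : ℝ) ^ κ := by
        gcongr
        rw [← Finset.prod_filter, Finset.prod_const]
        refine pow_le_pow_right₀ hA1 ?_
        calc _ ≤ (Finset.range N).card := Finset.card_le_card fun p hp => by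
              simpa using (Finset.mem_filter.1 hp).2
          _ = N := Finset.card_range N

/-- The points `3n` are spaced, so the sum is bounded uniformly in the shift `x`. -/
lemma exists_tsum_decay_sub_le {p : ℝ} (hp : 1 < p) :
    ∃ C : ℝ≥0, ∀ x : ℝ, ∑' n : ℤ, decay p (x - 3 * n) ≤ C := by
  set S : ℝ≥0∞ := ∑' n : ℤ, decay p n with hS
  have hSt : S ≠ ⊤ := by
    have h1 : Summable (fun n : ℤ => bracket (n : ℝ) ^ (-p)) := by
      refine Summable.of_norm_bounded_eventually (Real.summable_abs_int_rpow hp) ?_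
      filter_upwards [(Set.finite_singleton (0 : ℤ)).compl_mem_cofinite] with n hn
      have hn' : 0 < |(n : ℝ)| := by simpa using hn
      rw [Real.norm_of_nonneg (Real.rpow_nonneg (bracket_pos _).le _)]
      exact Real.rpow_le_rpow_of_nonpos hn' (by unfold bracket; linarith) (by linarith)
    exact h1.tsum_ofReal_ne_top
  refine ⟨(ENNReal.ofReal (2 ^ p) * S).toNNReal, fun x => ?_⟩
  rw [ENNReal.coe_toNNReal (ENNReal.mul_ne_top ENNReal.ofReal_ne_top hSt)]
  -- Recentring the sum at the integer nearest to `x / 3` makes it independent of `x`.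
  set m : ℤ := round (x / 3) with hm
  have key : ∀ n : ℤ, decay p (x - 3 * n) ≤ ENNReal.ofReal (2 ^ p) * decay p ((n - m : ℤ) : ℝ) := by
    intro n
    unfold decay
    rw [← ENNReal.ofReal_mul (by positivity)]
    refine ENNReal.ofReal_le_ofReal ?_
    have h1 : |x / 3 - m| ≤ 1 / 2 := abs_sub_round _
    have h2 : bracket ((n - m : ℤ) : ℝ) / 2 ≤ bracket (x - 3 * n) := by
      unfold bracket
      push_cast
      have h3 : |(n : ℝ) - m| ≤ |x / 3 - m| + |x - 3 * n| / 3 := by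
        have : (n : ℝ) - m = (x / 3 - m) - (x - 3 * n) / 3 := by ring
        rw [this]
        refine (abs_sub _ _).trans ?_
        rw [abs_div]; norm_num
      linarith [abs_nonneg (x - 3 * n)]
    calc bracket (x - 3 * n) ^ (-p) ≤ (bracket ((n - m : ℤ) : ℝ) / 2) ^ (-p) :=
          Real.rpow_le_rpow_of_nonpos (by linarith [bracket_pos ((n - m : ℤ) : ℝ)]) h2 (by linarith)
      _ = 2 ^ p * bracket ((n - m : ℤ) : ℝ) ^ (-p) := by
          rw [Real.div_rpow (bracket_pos _).le (by norm_num), Real.rpow_neg (by norm_num : (0:ℝ) ≤ 2)]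
          field_simp
  calc ∑' n : ℤ, decay p (x - 3 * n)
      ≤ ∑' n : ℤ, ENNReal.ofReal (2 ^ p) * decay p ((n - m : ℤ) : ℝ) := ENNReal.tsum_le_tsum key
    _ = ENNReal.ofReal (2 ^ p) * S := by
        rw [ENNReal.tsum_mul_left, hS]
        congr 1
        exact (Equiv.subRight m).tsum_eq (fun n : ℤ => decay p (n : ℝ))

/-- `|n|^{-a}` as an extended nonnegative number, for integers `n`; it is `0` at `n = 0`. -/
def intDecay (a : ℝ) (n : ℤ) : ℝ≥0∞ := if n = 0 then 0 else ENNReal.ofReal (|(n : ℝ)| ^ (-a))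

/-- In a product of two decaying factors the smaller base may carry both exponents. -/
lemma exists_tsum_intDecay_mul_decay_le {a c : ℝ} (ha : 0 ≤ a) (hc : 0 ≤ c) (h : 1 < a + c) :
    ∃ C : ℝ≥0, ∀ x : ℝ, ∑' n : ℤ, intDecay a n * decay c (x - 3 * n) ≤ C := by
  obtain ⟨C, hC⟩ := exists_tsum_decay_sub_le h
  set S : ℝ≥0∞ := ∑' n : ℤ, ENNReal.ofReal (|(n : ℝ)| ^ (-(a + c))) with hS
  have hSt : S ≠ ⊤ := (Real.summable_abs_int_rpow h).tsum_ofReal_ne_top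
  refine ⟨S.toNNReal + C, fun x => ?_⟩
  push_cast
  rw [ENNReal.coe_toNNReal hSt]
  calc ∑' n : ℤ, intDecay a n * decay c (x - 3 * n)
      ≤ ∑' n : ℤ, (ENNReal.ofReal (|(n : ℝ)| ^ (-(a + c))) + decay (a + c) (x - 3 * n)) := by
        refine ENNReal.tsum_le_tsum fun n => ?_
        unfold intDecay
        split_ifs with hn
        · simp
        have hn' : 0 < |(n : ℝ)| := by simpa using hn
        have hb := bracket_pos (x - 3 * n)
        unfold decay
        rw [← ENNReal.ofReal_mul (by positivity)]
        rcases le_total |(n : ℝ)| (bracket (x - 3 * n)) with hle | hle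
        · refine le_add_right (ENNReal.ofReal_le_ofReal ?_)
          rw [neg_add, Real.rpow_add hn']
          exact mul_le_mul_of_nonneg_left
            (Real.rpow_le_rpow_of_nonpos hn' hle (by linarith)) (by positivity)
        · refine le_add_left (ENNReal.ofReal_le_ofReal ?_)
          rw [neg_add, Real.rpow_add hb]
          exact mul_le_mul_of_nonneg_right
            (Real.rpow_le_rpow_of_nonpos hb hle (by linarith)) (by positivity)
    _ = S + ∑' n : ℤ, decay (a + c) (x - 3 * n) := ENNReal.tsum_add
    _ ≤ S + C := by gcongr; exact hC x

/-- The sum over the frequencies: if an integer-valued phase `P` has two divisors `A`, `B` that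
determine the index, then by the divisor bound a value of `P` is taken only a few times, and the
sum is controlled by a sum over the values of `P`. -/
lemma exists_tsum_phase_le {a c : ℝ} (ha : 0 < a) (hc : 0 ≤ c) (h : 1 < a / 2 + c) :
    ∃ C : ℝ≥0, ∀ {ι : Type} (P A B : ι → ℤ), (∀ i, A i ∣ P i) → (∀ i, B i ∣ P i) →
      Function.Injective (fun i => (A i, B i)) → ∀ x : ℝ,
        ∑' i, intDecay a (P i) * decay c (x - 3 * P i) ≤ C := by
  obtain ⟨D, hD0, hD⟩ := exists_card_divisors_le_rpow (κ := a / 4) (by linarith)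
  obtain ⟨C, hC⟩ := exists_tsum_intDecay_mul_decay_le (a := a / 2) (by linarith) hc h
  refine ⟨(4 * D ^ 2).toNNReal * C, fun {ι} P A B hA hB hAB x => ?_⟩
  let f : ℤ → ℝ≥0∞ := fun n => intDecay a n * decay c (x - 3 * n)
  -- A value `n ≠ 0` of the phase is encoded together with two signed divisors of it.
  let J : ℤ → Type := fun n => ({d // d ∈ n.natAbs.divisors} × Bool) ×
    ({d // d ∈ n.natAbs.divisors} × Bool)
  have hmem : ∀ (i : {i // P i ≠ 0}) (d : ℤ), d ∣ P i → d.natAbs ∈ (P i).natAbs.divisors := by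
    intro i d hd
    rw [Nat.mem_divisors]
    exact ⟨Int.natAbs_dvd_natAbs.2 hd, by simpa using i.2⟩
  let Φ : {i // P i ≠ 0} → Σ n : ℤ, J n := fun i => ⟨P i,
    ((⟨(A i).natAbs, hmem i _ (hA i)⟩, decide (0 ≤ A i)),
     (⟨(B i).natAbs, hmem i _ (hB i)⟩, decide (0 ≤ B i)))⟩
  have hΦ : Function.Injective Φ := by
    have hrec : ∀ m n : ℤ, m.natAbs = n.natAbs → (0 ≤ m ↔ 0 ≤ n) → m = n := by
      intro m n; omega
    let g : (Σ n : ℤ, J n) → (ℕ × Bool) × (ℕ × Bool) := fun z =>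
      ((z.2.1.1.1, z.2.1.2), (z.2.2.1.1, z.2.2.2))
    intro i j hij
    have h2 : g (Φ i) = g (Φ j) := by rw [hij]
    simp only [g, Φ, Prod.mk.injEq, decide_eq_decide] at h2
    exact Subtype.ext (hAB (Prod.ext (hrec _ _ h2.1.1 h2.1.2) (hrec _ _ h2.2.1 h2.2.2)))
  have hsupp : Function.support (fun i => f (P i)) ⊆ {i | P i ≠ 0} := by
    intro i hi h0
    exact hi (by simp [f, h0, intDecay])
  change ∑' i, f (P i) ≤ _
  calc ∑' i, f (P i) = ∑' i : {i // P i ≠ 0}, f (P i) :=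
        (tsum_subtype_eq_of_support_subset hsupp).symm
    _ = ∑' i, (fun z : Σ n : ℤ, J n => f z.1) (Φ i) := rfl
    _ ≤ ∑' z : Σ n : ℤ, J n, f z.1 := ENNReal.tsum_comp_le_tsum_of_injective hΦ _
    _ = ∑' n : ℤ, ∑' _ : J n, f n := ENNReal.tsum_sigma' _
    _ ≤ ∑' n : ℤ, ((4 * D ^ 2).toNNReal : ℝ≥0∞) * (intDecay (a / 2) n * decay c (x - 3 * n)) := by
        refine ENNReal.tsum_le_tsum fun n => ?_
        by_cases hn : n = 0
        · simp [f, hn, intDecay]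
        have hn' : 0 < |(n : ℝ)| := by simpa using hn
        rw [tsum_fintype, Finset.sum_const, nsmul_eq_mul, Finset.card_univ]
        simp only [f, J, intDecay, hn, if_false]
        simp only [Fintype.card_prod, Fintype.card_coe, Fintype.card_bool]
        rw [← mul_assoc (_ : ℝ≥0∞), ← mul_assoc (_ : ℝ≥0∞)]
        refine mul_le_mul' ?_ le_rfl
        have hd := hD n.natAbs (by simpa using hn)
        rw [Nat.cast_natAbs, Int.cast_abs] at hd
        set d := n.natAbs.divisors.card
        change _ ≤ ENNReal.ofReal (4 * D ^ 2) * _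
        rw [← ENNReal.ofReal_natCast, ← ENNReal.ofReal_mul (by positivity),
          ← ENNReal.ofReal_mul (by positivity)]
        refine ENNReal.ofReal_le_ofReal ?_
        have h1 : |(n : ℝ)| ^ (-(a / 2)) = (|(n : ℝ)| ^ (a / 4)) ^ 2 * |(n : ℝ)| ^ (-a) := by
          rw [← Real.rpow_natCast, ← Real.rpow_mul hn'.le, ← Real.rpow_add hn']
          congr 1; push_cast; ring
        rw [h1, ← mul_assoc (4 * D ^ 2)]
        refine mul_le_mul_of_nonneg_right ?_ (by positivity)
        push_cast
        calc (d : ℝ) * 2 * (d * 2) = 4 * (d : ℝ) ^ 2 := by ring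
          _ ≤ 4 * (D * |(n : ℝ)| ^ (a / 4)) ^ 2 := by gcongr
          _ = 4 * D ^ 2 * (|(n : ℝ)| ^ (a / 4)) ^ 2 := by ring
    _ ≤ _ := by
        rw [ENNReal.tsum_mul_left]; push_cast
        gcongr
        exact hC x

/-! ### Resonance function and pointwise multiplier bounds -/

/-- The resonance function `(k₁ + k₂)(k₂ + k₃)(k₁ + k₃)`. -/
def resonance (k₁ k₂ k₃ : ℤ) : ℤ := (k₁ + k₂) * (k₂ + k₃) * (k₁ + k₃)

/-- The output bracket is at most that of the first input times the square root of the resonance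
function. -/
lemma sq_bracket_add_add_le {x y z : ℝ} (ha : 1 ≤ |x + y|) (hb : 1 ≤ |y + z|)
    (hc : 1 ≤ |x + z|) :
    bracket (x + y + z) ^ 2 ≤ 64 * bracket x ^ 2 * |(x + y) * (y + z) * (x + z)| := by
  rw [abs_mul, abs_mul]
  have h1 : bracket (x + y + z) ≤ bracket x + |y + z| := by
    unfold bracket; rw [add_assoc]; linarith [abs_add_le x (y + z)]
  have h2 : |y + z| ≤ |x + y| + |x + z| + 2 * |x| := by
    rw [show y + z = (x + y) + (x + z) - 2 * x by ring]
    refine (abs_sub _ _).trans ?_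
    rw [abs_mul]; norm_num
    exact abs_add_le _ _
  have h0 := one_le_bracket x
  have hx : |x| = bracket x - 1 := by unfold bracket; ring
  have h3 := one_le_bracket (x + y + z)
  set a := |x + y|
  set b := |y + z|
  set c := |x + z|
  set X := bracket x
  have hac : a + c ≤ 2 * (a * c) := by nlinarith
  have hb2 : b ≤ 4 * X * (a * c) := by nlinarith [mul_le_mul ha hc (by norm_num) (by linarith)]
  have hac1 : 1 ≤ a * c := by nlinarith
  have hX : X ^ 2 ≤ X ^ 2 * (a * c * b) := by
    have : 1 ≤ a * c * b := by nlinarith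
    nlinarith
  have hbb : b ^ 2 ≤ 4 * X ^ 2 * (a * c * b) := by
    calc b ^ 2 = b * b := by ring
      _ ≤ (4 * X * (a * c)) * b := by gcongr
      _ ≤ (4 * X ^ 2 * (a * c)) * b := by gcongr; nlinarith
      _ = _ := by ring
  calc bracket (x + y + z) ^ 2 ≤ (X + b) ^ 2 := by gcongr
    _ ≤ 2 * X ^ 2 + 2 * b ^ 2 := by nlinarith [sq_nonneg (X - b)]
    _ ≤ 64 * (X ^ 2 * (a * c * b)) := by nlinarith
    _ = _ := by ring

lemma bracket_le_of_one_le_abs_add {x y : ℝ} (h : 1 ≤ |x + y|) :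
    bracket y ≤ 2 * bracket x * |x + y| := by
  have h1 : bracket y ≤ bracket x + |x + y| := by
    unfold bracket
    have : |y| = |(x + y) - x| := by ring_nf
    rw [this]; linarith [abs_sub (x + y) x]
  nlinarith [one_le_bracket x]

/-- Each of `y`, `z` differs from `-x`, and from the output `x + y + z`, by a factor of the resonance
function. -/
lemma bracket_mul_bracket_le {x y z : ℝ} (ha : 1 ≤ |x + y|) (hb : 1 ≤ |y + z|)
    (hc : 1 ≤ |x + z|) :
    bracket y * bracket z ≤
      4 * bracket (x + y + z) * bracket x * |(x + y) * (y + z) * (x + z)| := by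
  have e1 : bracket y ≤ 2 * bracket x * |x + y| := bracket_le_of_one_le_abs_add ha
  have e2 : bracket z ≤ 2 * bracket x * |x + z| := bracket_le_of_one_le_abs_add hc
  have e3 : bracket y ≤ 2 * bracket (x + y + z) * |x + z| := by
    have := @bracket_le_of_one_le_abs_add (x + y + z) (-y) (by ring_nf; ring_nf at hc; exact hc)
    rw [bracket_neg] at this; ring_nf at this ⊢; exact this
  have e4 : bracket z ≤ 2 * bracket (x + y + z) * |x + y| := by
    have := @bracket_le_of_one_le_abs_add (x + y + z) (-z) (by ring_nf; ring_nf at ha; exact ha)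
    rw [bracket_neg] at this; ring_nf at this ⊢; exact this
  rw [abs_mul, abs_mul]
  have h0 := one_le_bracket x
  have h3 := one_le_bracket (x + y + z)
  have hy := one_le_bracket y
  have hz := one_le_bracket z
  set a := |x + y|
  set b := |y + z|
  set c := |x + z|
  set X := bracket x
  set K := bracket (x + y + z)
  set Y := bracket y
  set Z := bracket z
  have h4 : (Y * Z) ^ 2 ≤ (4 * K * X * (a * c)) ^ 2 := by
    calc (Y * Z) ^ 2 = (Y * Y) * (Z * Z) := by ring
      _ ≤ ((2 * X * a) * (2 * K * c)) * ((2 * X * c) * (2 * K * a)) := by gcongr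
      _ = _ := by ring
  have h5 : Y * Z ≤ 4 * K * X * (a * c) := by
    exact (sq_le_sq₀ (by positivity) (by positivity)).1 h4
  calc Y * Z ≤ 4 * K * X * (a * c) := h5
    _ ≤ 4 * K * X * (a * c) * b := le_mul_of_one_le_right (by positivity) hb
    _ = _ := by ring

/-- The multiplier of the cubic term is controlled by a power strictly less than one half of the
resonance function. The three bounds available for the brackets combine linearly in the logarithms;
for `s ≥ 0` the condition `s₁ < s + 1` is the relevant one, for `s < 0` it is `s₁ < 3s + 1`. -/
lemma exists_multiplier_le {s s₁ : ℝ} (hs : -(1 / 2 : ℝ) < s)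
    (hs₁ : s₁ < min (s + 1) (3 * s + 1)) :
    ∃ η : ℝ, 0 < η ∧ η ≤ 1 ∧ ∃ C : ℝ≥0, ∀ k₁ k₂ k₃ : ℤ, resonance k₁ k₂ k₃ ≠ 0 →
      decay (-s₁) ((k₁ + k₂ + k₃ : ℤ) : ℝ) * decay (s + 1) k₁ * decay s k₂ * decay s k₃ ≤
        C * intDecay (-((1 - η) / 2)) (resonance k₁ k₂ k₃) := by
  have h1 := lt_min_iff.1 hs₁
  set η : ℝ := min (min (s + 1) (3 * s + 1) - s₁) (min 1 (1 + 2 * s)) with hη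
  have hη0 : 0 < η := by
    rw [hη]; refine lt_min (by linarith) (lt_min one_pos (by linarith))
  have hη1 : η ≤ 1 := (min_le_right _ _).trans (min_le_left _ _)
  have hη2 : η ≤ 1 + 2 * s := (min_le_right _ _).trans (min_le_right _ _)
  have hη3 : s₁ ≤ s + 1 - η := by
    have : η ≤ min (s + 1) (3 * s + 1) - s₁ := min_le_left _ _
    linarith [min_le_left (s + 1) (3 * s + 1)]
  have hη4 : s₁ ≤ 3 * s + 1 - η := by
    have : η ≤ min (s + 1) (3 * s + 1) - s₁ := min_le_left _ _
    linarith [min_le_right (s + 1) (3 * s + 1)]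
  refine ⟨η, hη0, hη1, (Real.exp (Real.log 64 + Real.log 4)).toNNReal, fun k₁ k₂ k₃ hR => ?_⟩
  have hint : ∀ n : ℤ, n ≠ 0 → 1 ≤ |(n : ℝ)| := fun n hn => by
    exact_mod_cast Int.one_le_abs hn
  obtain ⟨⟨ha, hb⟩, hc⟩ : ((k₁ + k₂ ≠ 0 ∧ k₂ + k₃ ≠ 0) ∧ k₁ + k₃ ≠ 0) := by
    simpa [resonance, not_or] using hR
  have ha' : 1 ≤ |(k₁ : ℝ) + k₂| := by exact_mod_cast hint _ ha
  have hb' : 1 ≤ |(k₂ : ℝ) + k₃| := by exact_mod_cast hint _ hb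
  have hc' : 1 ≤ |(k₁ : ℝ) + k₃| := by exact_mod_cast hint _ hc
  have hR1 : 1 ≤ |((resonance k₁ k₂ k₃ : ℤ) : ℝ)| := hint _ hR
  have eA := sq_bracket_add_add_le ha' hb' hc'
  have eB := bracket_mul_bracket_le ha' hb' hc'
  have eC : bracket ((k₁ : ℝ) + k₂ + k₃) ≤ bracket k₁ * bracket k₂ * bracket k₃ :=
    (bracket_add_le _ _).trans (by
      gcongr
      · exact (bracket_pos _).le
      · exact bracket_add_le _ _)
  have hcast : (((k₁ : ℝ) + k₂) * (k₂ + k₃) * (k₁ + k₃)) = ((resonance k₁ k₂ k₃ : ℤ) : ℝ) := by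
    unfold resonance; push_cast; ring
  rw [hcast] at eA eB
  have hcast2 : (((k₁ + k₂ + k₃ : ℤ)) : ℝ) = (k₁ : ℝ) + k₂ + k₃ := by push_cast; ring
  rw [hcast2]
  unfold intDecay decay
  rw [if_neg hR]
  set R := |((resonance k₁ k₂ k₃ : ℤ) : ℝ)|
  have hX := one_le_bracket k₁
  have hY := one_le_bracket k₂
  have hZ := one_le_bracket k₃
  have hK := one_le_bracket ((k₁ : ℝ) + k₂ + k₃)
  set X := bracket (k₁ : ℝ)
  set Y := bracket (k₂ : ℝ)
  set Z := bracket (k₃ : ℝ)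
  set K := bracket ((k₁ : ℝ) + k₂ + k₃)
  have pX : 0 < X := by linarith
  have pY : 0 < Y := by linarith
  have pZ : 0 < Z := by linarith
  have pK : 0 < K := by linarith
  have pR : 0 < R := by linarith
  -- The three bounds, in logarithmic form.
  have lA : 2 * Real.log K ≤ Real.log 64 + 2 * Real.log X + Real.log R := by
    have := Real.log_le_log (by positivity) eA
    rw [Real.log_mul (by positivity) pR.ne', Real.log_mul (by norm_num) (by positivity),
      Real.log_pow, Real.log_pow] at this
    exact_mod_cast this
  have lB : Real.log Y + Real.log Z ≤ Real.log 4 + Real.log K + Real.log X + Real.log R := by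
    have := Real.log_le_log (by positivity) eB
    rwa [Real.log_mul (by positivity) pR.ne', Real.log_mul (by positivity) pX.ne',
      Real.log_mul (by norm_num) pK.ne', Real.log_mul pY.ne' pZ.ne'] at this
  have lC : Real.log K ≤ Real.log X + Real.log Y + Real.log Z := by
    have := Real.log_le_log (by positivity) eC
    rwa [Real.log_mul (by positivity) pZ.ne', Real.log_mul pX.ne' pY.ne'] at this
  have lX := Real.log_nonneg hX
  have lK := Real.log_nonneg hK
  have l64 := Real.log_nonneg (show (1 : ℝ) ≤ 64 by norm_num)
  have l4 := Real.log_nonneg (show (1 : ℝ) ≤ 4 by norm_num)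
  rw [show ((Real.exp (Real.log 64 + Real.log 4)).toNNReal : ℝ≥0∞) =
    ENNReal.ofReal (Real.exp (Real.log 64 + Real.log 4)) from rfl,
    ← ENNReal.ofReal_mul (by positivity), ← ENNReal.ofReal_mul (by positivity),
    ← ENNReal.ofReal_mul (by positivity), ← ENNReal.ofReal_mul (by positivity)]
  refine ENNReal.ofReal_le_ofReal ?_
  rw [Real.rpow_def_of_pos pK, Real.rpow_def_of_pos pX, Real.rpow_def_of_pos pY,
    Real.rpow_def_of_pos pZ, Real.rpow_def_of_pos pR, ← Real.exp_add, ← Real.exp_add,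
    ← Real.exp_add, ← Real.exp_add]
  refine Real.exp_le_exp.2 ?_
  rcases le_total 0 s with h0 | h0
  · have t1 := mul_le_mul_of_nonneg_left lA (show 0 ≤ (1 - η) / 2 by linarith)
    have t2 := mul_le_mul_of_nonneg_left lC h0
    have t3 := mul_le_mul_of_nonneg_right hη3 lK
    have t4 := mul_nonneg hη0.le lX
    have t5 := mul_nonneg (show 0 ≤ 1 - (1 - η) / 2 by linarith) l64
    linarith
  · have t1 := mul_le_mul_of_nonneg_left lA (show 0 ≤ (1 + 2 * s - η) / 2 by linarith)
    have t2 := mul_le_mul_of_nonneg_left lB (show 0 ≤ -s by linarith)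
    have t3 := mul_le_mul_of_nonneg_right hη4 lK
    have t4 := mul_nonneg hη0.le lX
    have t5 := mul_nonneg (show 0 ≤ 1 - (1 + 2 * s - η) / 2 by linarith) l64
    have t6 := mul_nonneg (show 0 ≤ 1 + s by linarith) l4
    linarith

/-! ### Schur-type tests for multilinear expressions -/

/-- The Cauchy–Schwarz inequality, squared. -/
lemma sq_lintegral_mul_le {Y : Type*} [MeasurableSpace Y] (ν : Measure Y) {f g : Y → ℝ≥0∞}
    (hf : AEMeasurable f ν) (hg : AEMeasurable g ν) :
    (∫⁻ y, f y * g y ∂ν) ^ 2 ≤ (∫⁻ y, f y ^ 2 ∂ν) * ∫⁻ y, g y ^ 2 ∂ν := by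
  have h := ENNReal.lintegral_mul_le_Lp_mul_Lq ν Real.HolderConjugate.two_two hf hg
  have h2 : ∀ x : ℝ≥0∞, (x ^ (1 / 2 : ℝ)) ^ 2 = x := fun x => by
    rw [← ENNReal.rpow_natCast, ← ENNReal.rpow_mul]; norm_num
  calc (∫⁻ y, f y * g y ∂ν) ^ 2 ≤ _ := pow_le_pow_left₀ (by positivity) h 2
    _ = _ := by rw [mul_pow, h2, h2]; norm_cast

/-- Duality in `L²` for nonnegative functions. -/
lemma lintegral_sq_le_of_forall_lintegral_mul {Y : Type*} [MeasurableSpace Y] (ν : Measure Y)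
    [SigmaFinite ν] {T : Y → ℝ≥0∞} {A : ℝ≥0∞}
    (h : ∀ g : Y → ℝ≥0∞, Measurable g → (∫⁻ y, T y * g y ∂ν) ^ 2 ≤ A * ∫⁻ y, g y ^ 2 ∂ν) :
    ∫⁻ y, T y ^ 2 ∂ν ≤ A := by
  -- A simple function below `T²` of finite integral is needed, in order to divide by the integral.
  refine le_of_forall_lt fun L hL => ?_
  obtain ⟨g, hg, hgt, hLg⟩ : ∃ g : SimpleFunc Y ℝ≥0, (∀ y, (g y : ℝ≥0∞) ≤ T y ^ 2) ∧
      ∫⁻ y, (g y : ℝ≥0∞) ∂ν < ⊤ ∧ L < ∫⁻ y, (g y : ℝ≥0∞) ∂ν := by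
    rw [lintegral_eq_nnreal] at hL
    simp only [lt_iSup_iff] at hL
    obtain ⟨f, hf, hLf⟩ := hL
    rw [← SimpleFunc.lintegral_eq_lintegral] at hLf
    obtain ⟨g, hg, hgt, hLg⟩ := SimpleFunc.exists_lt_lintegral_simpleFunc_of_lt_lintegral hLf
    exact ⟨g, fun y => (ENNReal.coe_le_coe.2 (hg y)).trans (hf y), hgt, hLg⟩
  refine hLg.trans_le ?_
  set I := ∫⁻ y, (g y : ℝ≥0∞) ∂ν with hI
  have hs : ∀ x : ℝ≥0∞, (x ^ (1 / 2 : ℝ)) ^ 2 = x := fun x => by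
    rw [← ENNReal.rpow_natCast, ← ENNReal.rpow_mul]; norm_num
  have h1 := h (fun y => (g y : ℝ≥0∞) ^ (1 / 2 : ℝ)) (by fun_prop)
  simp only [hs] at h1
  have h2 : I ≤ ∫⁻ y, T y * (g y : ℝ≥0∞) ^ (1 / 2 : ℝ) ∂ν := by
    refine lintegral_mono fun y => ?_
    have h3 : (g y : ℝ≥0∞) ^ (1 / 2 : ℝ) ≤ T y := by
      rw [← ENNReal.pow_le_pow_left_iff two_ne_zero, hs]; exact hg y
    calc (g y : ℝ≥0∞) = (g y : ℝ≥0∞) ^ (1 / 2 : ℝ) * (g y : ℝ≥0∞) ^ (1 / 2 : ℝ) := by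
          rw [← sq, hs]
      _ ≤ _ := by gcongr
  have h4 : I * I ≤ A * I := by
    rw [← sq]; exact (pow_le_pow_left₀ (by positivity) h2 2).trans h1
  rcases eq_or_ne I 0 with h0 | h0
  · rw [h0]; positivity
  · exact (ENNReal.mul_le_mul_iff_left h0 hgt.ne).1 h4

section Product

variable {X : Type*} [MeasurableSpace X] (μ : Measure X) [SigmaFinite μ]

/-- Cauchy–Schwarz on the triple product, for a kernel `W` that is square integrable in the last two
variables uniformly in the first. -/
lemma sq_lintegral_prod_mul_le {W b : X × X × X → ℝ≥0∞} {h : X → ℝ≥0∞} {B : ℝ≥0∞}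
    (hW : Measurable W) (hh : Measurable h) (hb : Measurable b)
    (hB : ∀ x, ∫⁻ r, W (x, r) ^ 2 ∂μ.prod μ ≤ B) :
    (∫⁻ q, W q * h q.1 * b q ∂μ.prod (μ.prod μ)) ^ 2 ≤
      B * (∫⁻ x, h x ^ 2 ∂μ) * ∫⁻ q, b q ^ 2 ∂μ.prod (μ.prod μ) := by
  refine (sq_lintegral_mul_le _ (by fun_prop) (by fun_prop)).trans ?_
  gcongr
  rw [lintegral_prod _ (by fun_prop)]
  calc ∫⁻ x, ∫⁻ r, (W (x, r) * h x) ^ 2 ∂μ.prod μ ∂μ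
      ≤ ∫⁻ x, B * h x ^ 2 ∂μ := by
        refine lintegral_mono fun x => ?_
        simp only [mul_pow]
        rw [lintegral_mul_const _ (by fun_prop)]
        gcongr
        exact hB x
    _ = _ := lintegral_const_mul _ (by fun_prop)

lemma lintegral_prod_swap_fst {Φ : X → X → X → ℝ≥0∞}
    (hΦ : Measurable fun q : X × X × X => Φ q.1 q.2.1 q.2.2) :
    ∫⁻ q : X × X × X, Φ q.1 q.2.1 q.2.2 ∂μ.prod (μ.prod μ) =
      ∫⁻ q : X × X × X, Φ q.2.1 q.1 q.2.2 ∂μ.prod (μ.prod μ) := by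
  have h1 : ∀ Ψ : X → X → X → ℝ≥0∞, Measurable (fun q : X × X × X => Ψ q.1 q.2.1 q.2.2) →
      ∫⁻ q : X × X × X, Ψ q.1 q.2.1 q.2.2 ∂μ.prod (μ.prod μ) =
        ∫⁻ x, ∫⁻ y, ∫⁻ z, Ψ x y z ∂μ ∂μ ∂μ := by
    intro Ψ hΨ
    rw [lintegral_prod _ hΨ.aemeasurable]
    refine lintegral_congr fun x => ?_
    rw [lintegral_prod _ (by exact (hΨ.comp (measurable_const.prodMk measurable_id)).aemeasurable)]
  rw [h1 Φ hΦ, h1 (fun y x z => Φ x y z) (by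
    exact hΦ.comp (measurable_snd.fst.prodMk (measurable_fst.prodMk measurable_snd.snd)))]
  refine lintegral_lintegral_swap ?_
  have h2 : Measurable fun w : (X × X) × X => Φ w.1.1 w.1.2 w.2 :=
    hΦ.comp (measurable_fst.fst.prodMk (measurable_fst.snd.prodMk measurable_snd))
  exact h2.lintegral_prod_right'.aemeasurable

lemma lintegral_prod_swap_snd {Φ : X → X → X → ℝ≥0∞}
    (hΦ : Measurable fun q : X × X × X => Φ q.1 q.2.1 q.2.2) :
    ∫⁻ q : X × X × X, Φ q.1 q.2.1 q.2.2 ∂μ.prod (μ.prod μ) =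
      ∫⁻ q : X × X × X, Φ q.1 q.2.2 q.2.1 ∂μ.prod (μ.prod μ) := by
  have hΦ' : Measurable fun q : X × X × X => Φ q.1 q.2.2 q.2.1 :=
    hΦ.comp (measurable_fst.prodMk (measurable_snd.snd.prodMk measurable_snd.fst))
  rw [lintegral_prod _ hΦ.aemeasurable, lintegral_prod _ hΦ'.aemeasurable]
  refine lintegral_congr fun x => ?_
  have hx : Measurable fun r : X × X => Φ x r.1 r.2 :=
    hΦ.comp (measurable_const.prodMk measurable_id)
  exact (lintegral_prod_swap (fun r : X × X => Φ x r.1 r.2)).symm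

end Product

section Group

variable {X : Type*} [AddCommGroup X] [MeasurableSpace X] [MeasurableAdd₂ X]
  (μ : Measure X) [SigmaFinite μ] [μ.IsAddLeftInvariant]

lemma lintegral_prod_mul_translate {u g e : X → ℝ≥0∞} (hu : Measurable u) (hg : Measurable g)
    (he : Measurable e) {c : X × X → X} (hc : Measurable c) :
    ∫⁻ q : X × X × X, u (q.1 + c q.2) * g q.2.1 * e q.2.2 ∂μ.prod (μ.prod μ) =
      (∫⁻ x, u x ∂μ) * (∫⁻ x, g x ∂μ) * ∫⁻ x, e x ∂μ := by
  rw [lintegral_prod_symm _ (by fun_prop)]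
  have h1 : ∀ r : X × X, ∫⁻ x, u (x + c r) * g r.1 * e r.2 ∂μ =
      (∫⁻ x, u x ∂μ) * (g r.1 * e r.2) := by
    intro r
    simp only [mul_assoc]
    rw [lintegral_mul_const _ (by fun_prop), lintegral_add_right_eq_self u]
  simp only [h1]
  rw [lintegral_const_mul _ (by fun_prop), lintegral_prod_mul hg.aemeasurable he.aemeasurable,
    mul_assoc]

variable [MeasurableNeg X]

lemma lintegral_prod_mul_reflect [μ.IsNegInvariant] {u g e : X → ℝ≥0∞} (hu : Measurable u)
    (hg : Measurable g) (he : Measurable e) {c : X × X → X} (hc : Measurable c) :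
    ∫⁻ q : X × X × X, u (c q.2 - q.1) * g q.2.1 * e q.2.2 ∂μ.prod (μ.prod μ) =
      (∫⁻ x, u x ∂μ) * (∫⁻ x, g x ∂μ) * ∫⁻ x, e x ∂μ := by
  have := lintegral_prod_mul_translate μ (u := fun x => u (-x)) (by fun_prop) hg he
    (c := fun r => - c r) (by fun_prop)
  rw [lintegral_neg_eq_self u] at this
  rw [← this]
  simp only [neg_add, neg_neg, sub_eq_add_neg, add_comm]

variable {M : X → X → X → ℝ≥0∞} {h F G H : X → ℝ≥0∞} {B : ℝ≥0∞}

/-- The quadrilinear form is controlled by the `L²` norm of its kernel at a fixed value of the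
output variable. -/
lemma sq_quadrilinear_le_of_output (hM : Measurable fun q : X × X × X => M q.1 q.2.1 q.2.2)
    (hh : Measurable h) (hF : Measurable F) (hG : Measurable G) (hH : Measurable H)
    (hB : ∀ p, ∫⁻ r : X × X, M p r.1 r.2 ^ 2 ∂μ.prod μ ≤ B) :
    (∫⁻ q : X × X × X, M q.1 q.2.1 q.2.2 * (h q.1 * F (q.1 - q.2.1 - q.2.2) * G q.2.1 * H q.2.2)
      ∂μ.prod (μ.prod μ)) ^ 2 ≤
      B * ((∫⁻ x, h x ^ 2 ∂μ) * (∫⁻ x, F x ^ 2 ∂μ) * (∫⁻ x, G x ^ 2 ∂μ) * ∫⁻ x, H x ^ 2 ∂μ) := by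
  have key := sq_lintegral_prod_mul_le μ (W := fun q : X × X × X => M q.1 q.2.1 q.2.2)
    (b := fun q => F (q.1 - q.2.1 - q.2.2) * G q.2.1 * H q.2.2) hM hh (by fun_prop) hB
  have e1 : ∫⁻ q : X × X × X, (F (q.1 - q.2.1 - q.2.2) * G q.2.1 * H q.2.2) ^ 2
      ∂μ.prod (μ.prod μ) = (∫⁻ x, F x ^ 2 ∂μ) * (∫⁻ x, G x ^ 2 ∂μ) * ∫⁻ x, H x ^ 2 ∂μ := by
    have := lintegral_prod_mul_translate μ (u := fun x => F x ^ 2) (g := fun x => G x ^ 2)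
      (e := fun x => H x ^ 2) (by fun_prop) (by fun_prop) (by fun_prop)
      (c := fun r => - r.1 - r.2) (by fun_prop)
    rw [← this]
    refine lintegral_congr fun q => ?_
    rw [show q.1 - q.2.1 - q.2.2 = q.1 + (-q.2.1 - q.2.2) by abel]; ring
  rw [e1] at key
  refine le_trans (le_of_eq ?_) (key.trans (le_of_eq (by ring)))
  congr 1
  exact lintegral_congr fun q => by ring

/-- The same with the variable `x = p - y - z` of the first factor `F` fixed instead of the output
variable `p`. -/
lemma sq_quadrilinear_le_of_fst (hM : Measurable fun q : X × X × X => M q.1 q.2.1 q.2.2)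
    (hh : Measurable h) (hF : Measurable F) (hG : Measurable G) (hH : Measurable H)
    (hB : ∀ x, ∫⁻ r : X × X, M (x + r.1 + r.2) r.1 r.2 ^ 2 ∂μ.prod μ ≤ B) :
    (∫⁻ q : X × X × X, M q.1 q.2.1 q.2.2 * (h q.1 * F (q.1 - q.2.1 - q.2.2) * G q.2.1 * H q.2.2)
      ∂μ.prod (μ.prod μ)) ^ 2 ≤
      B * ((∫⁻ x, h x ^ 2 ∂μ) * (∫⁻ x, F x ^ 2 ∂μ) * (∫⁻ x, G x ^ 2 ∂μ) * ∫⁻ x, H x ^ 2 ∂μ) := by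
  have hM' : Measurable fun q : X × X × X => M (q.1 + q.2.1 + q.2.2) q.2.1 q.2.2 :=
    hM.comp (g := fun q : X × X × X => M q.1 q.2.1 q.2.2)
      (f := fun q : X × X × X => (q.1 + q.2.1 + q.2.2, q.2.1, q.2.2)) (by fun_prop)
  have key := sq_lintegral_prod_mul_le μ
    (W := fun q : X × X × X => M (q.1 + q.2.1 + q.2.2) q.2.1 q.2.2)
    (b := fun q => h (q.1 + q.2.1 + q.2.2) * G q.2.1 * H q.2.2) hM' hF (by fun_prop) hB
  have e1 : ∫⁻ q : X × X × X, (h (q.1 + q.2.1 + q.2.2) * G q.2.1 * H q.2.2) ^ 2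
      ∂μ.prod (μ.prod μ) = (∫⁻ x, h x ^ 2 ∂μ) * (∫⁻ x, G x ^ 2 ∂μ) * ∫⁻ x, H x ^ 2 ∂μ := by
    have := lintegral_prod_mul_translate μ (u := fun x => h x ^ 2) (g := fun x => G x ^ 2)
      (e := fun x => H x ^ 2) (by fun_prop) (by fun_prop) (by fun_prop)
      (c := fun r => r.1 + r.2) (by fun_prop)
    rw [← this]
    refine lintegral_congr fun q => ?_
    rw [add_assoc]; ring
  have e2 : ∫⁻ q : X × X × X,
      M q.1 q.2.1 q.2.2 * (h q.1 * F (q.1 - q.2.1 - q.2.2) * G q.2.1 * H q.2.2)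
        ∂μ.prod (μ.prod μ) =
      ∫⁻ q : X × X × X, M (q.1 + q.2.1 + q.2.2) q.2.1 q.2.2 * F q.1 *
        (h (q.1 + q.2.1 + q.2.2) * G q.2.1 * H q.2.2) ∂μ.prod (μ.prod μ) := by
    conv_lhs => rw [lintegral_prod_symm _ (by fun_prop)]
    conv_rhs => rw [lintegral_prod_symm _ (by fun_prop)]
    refine lintegral_congr fun r => ?_
    rw [← lintegral_add_right_eq_self _ (r.1 + r.2)]
    refine lintegral_congr fun x => ?_
    rw [show x + (r.1 + r.2) - r.1 - r.2 = x by abel, ← add_assoc]; ring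
  rw [e1] at key
  rw [e2]
  exact key.trans (le_of_eq (by ring))

variable [μ.IsNegInvariant]

/-- The same with the variable of the second factor `G` fixed. -/
lemma sq_quadrilinear_le_of_snd (hM : Measurable fun q : X × X × X => M q.1 q.2.1 q.2.2)
    (hh : Measurable h) (hF : Measurable F) (hG : Measurable G) (hH : Measurable H)
    (hB : ∀ y, ∫⁻ r : X × X, M r.1 y r.2 ^ 2 ∂μ.prod μ ≤ B) :
    (∫⁻ q : X × X × X, M q.1 q.2.1 q.2.2 * (h q.1 * F (q.1 - q.2.1 - q.2.2) * G q.2.1 * H q.2.2)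
      ∂μ.prod (μ.prod μ)) ^ 2 ≤
      B * ((∫⁻ x, h x ^ 2 ∂μ) * (∫⁻ x, F x ^ 2 ∂μ) * (∫⁻ x, G x ^ 2 ∂μ) * ∫⁻ x, H x ^ 2 ∂μ) := by
  have hM' : Measurable fun q : X × X × X => M q.2.1 q.1 q.2.2 :=
    hM.comp (g := fun q : X × X × X => M q.1 q.2.1 q.2.2)
      (f := fun q : X × X × X => (q.2.1, q.1, q.2.2)) (by fun_prop)
  have key := sq_lintegral_prod_mul_le μ
    (W := fun q : X × X × X => M q.2.1 q.1 q.2.2)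
    (b := fun q => F (q.2.1 - q.1 - q.2.2) * h q.2.1 * H q.2.2) hM' hG (by fun_prop) hB
  have e1 : ∫⁻ q : X × X × X, (F (q.2.1 - q.1 - q.2.2) * h q.2.1 * H q.2.2) ^ 2
      ∂μ.prod (μ.prod μ) = (∫⁻ x, F x ^ 2 ∂μ) * (∫⁻ x, h x ^ 2 ∂μ) * ∫⁻ x, H x ^ 2 ∂μ := by
    have := lintegral_prod_mul_reflect μ (u := fun x => F x ^ 2) (g := fun x => h x ^ 2)
      (e := fun x => H x ^ 2) (by fun_prop) (by fun_prop) (by fun_prop)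
      (c := fun r => r.1 - r.2) (by fun_prop)
    rw [← this]
    refine lintegral_congr fun q => ?_
    rw [show q.2.1 - q.1 - q.2.2 = q.2.1 - q.2.2 - q.1 by abel]; ring
  have e2 := lintegral_prod_swap_fst μ
    (Φ := fun p y z => M p y z * (h p * F (p - y - z) * G y * H z)) (by fun_prop)
  rw [e1] at key
  rw [e2]
  refine le_trans (le_of_eq ?_) (key.trans (le_of_eq (by ring)))
  congr 1
  exact lintegral_congr fun q => by ring

/-- The same with the variable of the third factor `H` fixed. -/
lemma sq_quadrilinear_le_of_thd (hM : Measurable fun q : X × X × X => M q.1 q.2.1 q.2.2)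
    (hh : Measurable h) (hF : Measurable F) (hG : Measurable G) (hH : Measurable H)
    (hB : ∀ z, ∫⁻ r : X × X, M r.1 r.2 z ^ 2 ∂μ.prod μ ≤ B) :
    (∫⁻ q : X × X × X, M q.1 q.2.1 q.2.2 * (h q.1 * F (q.1 - q.2.1 - q.2.2) * G q.2.1 * H q.2.2)
      ∂μ.prod (μ.prod μ)) ^ 2 ≤
      B * ((∫⁻ x, h x ^ 2 ∂μ) * (∫⁻ x, F x ^ 2 ∂μ) * (∫⁻ x, G x ^ 2 ∂μ) * ∫⁻ x, H x ^ 2 ∂μ) := by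
  have hM' : Measurable fun q : X × X × X => M q.1 q.2.2 q.2.1 :=
    hM.comp (g := fun q : X × X × X => M q.1 q.2.1 q.2.2)
      (f := fun q : X × X × X => (q.1, q.2.2, q.2.1)) (by fun_prop)
  have key := sq_quadrilinear_le_of_snd μ (M := fun p z y => M p y z) hM' hh hF hH hG hB
  have e2 := lintegral_prod_swap_snd μ
    (Φ := fun p y z => M p y z * (h p * F (p - y - z) * G y * H z)) (by fun_prop)
  rw [e2]
  refine le_trans (le_of_eq ?_) (key.trans (le_of_eq (by ring)))
  congr 1
  refine lintegral_congr fun q => ?_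
  rw [show q.1 - q.2.2 - q.2.1 = q.1 - q.2.1 - q.2.2 by abel]; ring

/-- A trilinear operator is bounded on `L²` if its kernel splits into four parts, each of which is
square integrable uniformly in one of the four variables. -/
lemma lintegral_sq_trilinear_le {M₀ M₁ M₂ M₃ : X → X → X → ℝ≥0∞}
    (hM : Measurable fun q : X × X × X => M q.1 q.2.1 q.2.2)
    (hM₀ : Measurable fun q : X × X × X => M₀ q.1 q.2.1 q.2.2)
    (hM₁ : Measurable fun q : X × X × X => M₁ q.1 q.2.1 q.2.2)
    (hM₂ : Measurable fun q : X × X × X => M₂ q.1 q.2.1 q.2.2)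
    (hM₃ : Measurable fun q : X × X × X => M₃ q.1 q.2.1 q.2.2)
    (hle : ∀ p y z, M p y z ≤ M₀ p y z + M₁ p y z + M₂ p y z + M₃ p y z)
    (hB₀ : ∀ p, ∫⁻ r : X × X, M₀ p r.1 r.2 ^ 2 ∂μ.prod μ ≤ B)
    (hB₁ : ∀ x, ∫⁻ r : X × X, M₁ (x + r.1 + r.2) r.1 r.2 ^ 2 ∂μ.prod μ ≤ B)
    (hB₂ : ∀ y, ∫⁻ r : X × X, M₂ r.1 y r.2 ^ 2 ∂μ.prod μ ≤ B)
    (hB₃ : ∀ z, ∫⁻ r : X × X, M₃ r.1 r.2 z ^ 2 ∂μ.prod μ ≤ B)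
    (hF : Measurable F) (hG : Measurable G) (hH : Measurable H) :
    ∫⁻ p, (∫⁻ r : X × X, M p r.1 r.2 * (F (p - r.1 - r.2) * G r.1 * H r.2) ∂μ.prod μ) ^ 2 ∂μ ≤
      16 * B * ((∫⁻ x, F x ^ 2 ∂μ) * (∫⁻ x, G x ^ 2 ∂μ) * ∫⁻ x, H x ^ 2 ∂μ) := by
  refine lintegral_sq_le_of_forall_lintegral_mul μ fun h hh => ?_
  set D := B * ((∫⁻ x, h x ^ 2 ∂μ) * (∫⁻ x, F x ^ 2 ∂μ) * (∫⁻ x, G x ^ 2 ∂μ) *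
    ∫⁻ x, H x ^ 2 ∂μ) with hD
  have hsqrt : ∀ a : ℝ≥0∞, a ^ 2 ≤ D → a ≤ D ^ (1 / 2 : ℝ) := by
    intro a ha
    rw [← ENNReal.pow_le_pow_left_iff two_ne_zero]
    refine ha.trans (le_of_eq ?_)
    rw [← ENNReal.rpow_natCast, ← ENNReal.rpow_mul]; norm_num
  let Q : (X → X → X → ℝ≥0∞) → ℝ≥0∞ := fun N => ∫⁻ q : X × X × X, N q.1 q.2.1 q.2.2 *
    (h q.1 * F (q.1 - q.2.1 - q.2.2) * G q.2.1 * H q.2.2) ∂μ.prod (μ.prod μ)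
  have q0 : Q M₀ ≤ _ := hsqrt _ (sq_quadrilinear_le_of_output μ hM₀ hh hF hG hH hB₀)
  have q1 : Q M₁ ≤ _ := hsqrt _ (sq_quadrilinear_le_of_fst μ hM₁ hh hF hG hH hB₁)
  have q2 : Q M₂ ≤ _ := hsqrt _ (sq_quadrilinear_le_of_snd μ hM₂ hh hF hG hH hB₂)
  have q3 : Q M₃ ≤ _ := hsqrt _ (sq_quadrilinear_le_of_thd μ hM₃ hh hF hG hH hB₃)
  have hQ : ∫⁻ p, (∫⁻ r : X × X, M p r.1 r.2 * (F (p - r.1 - r.2) * G r.1 * H r.2) ∂μ.prod μ) * h p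
      ∂μ = Q M := by
    simp only [Q]
    rw [lintegral_prod _ (by fun_prop)]
    refine lintegral_congr fun p => ?_
    have hMp : Measurable fun r : X × X => M p r.1 r.2 :=
      hM.comp (g := fun q : X × X × X => M q.1 q.2.1 q.2.2) (f := fun r : X × X => (p, r.1, r.2))
        (by fun_prop)
    rw [← lintegral_mul_const _ (by fun_prop)]
    exact lintegral_congr fun r => by ring
  have hQle : Q M ≤ Q M₀ + Q M₁ + Q M₂ + Q M₃ := by
    let A : X × X × X → ℝ≥0∞ := fun q => h q.1 * F (q.1 - q.2.1 - q.2.2) * G q.2.1 * H q.2.2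
    calc Q M ≤ ∫⁻ q : X × X × X, (M₀ q.1 q.2.1 q.2.2 * A q + M₁ q.1 q.2.1 q.2.2 * A q +
          M₂ q.1 q.2.1 q.2.2 * A q + M₃ q.1 q.2.1 q.2.2 * A q) ∂μ.prod (μ.prod μ) := by
          refine lintegral_mono fun q => ?_
          simp only [← add_mul]
          exact mul_le_mul_left (hle _ _ _) _
      _ = _ := by
          rw [lintegral_add_left, lintegral_add_left, lintegral_add_left]
          all_goals fun_prop
  rw [hQ]
  calc Q M ^ 2 ≤ (4 * D ^ (1 / 2 : ℝ)) ^ 2 := by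
        gcongr
        refine hQle.trans ((add_le_add (add_le_add (add_le_add q0 q1) q2) q3).trans (le_of_eq ?_))
        ring
    _ = 16 * D := by
        rw [mul_pow, ← ENNReal.rpow_natCast (D ^ (1 / 2 : ℝ)), ← ENNReal.rpow_mul]; norm_num
    _ = _ := by rw [hD]; ring

end Group

/-! ### The trilinear estimate on the Fourier side -/

/-- The measure `dk dτ` on `ℤ × ℝ`. -/
abbrev freqMeasure : Measure (ℤ × ℝ) := Measure.count.prod volume

/-- The modulation `τ - k³`. -/
def modulation (p : ℤ × ℝ) : ℝ := p.2 - (p.1 : ℝ) ^ 3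

@[fun_prop]
lemma measurable_modulation : Measurable modulation := by
  unfold modulation
  have : Measurable (fun k : ℤ => (k : ℝ)) := measurable_of_countable _
  fun_prop

/-- The resonance identity. -/
lemma modulation_add_add (x y z : ℤ × ℝ) :
    modulation (x + y + z) = modulation x + modulation y + modulation z -
      3 * resonance x.1 y.1 z.1 := by
  simp only [modulation, resonance, Prod.fst_add, Prod.snd_add]; push_cast; ring

lemma lintegral_freqMeasure_prod {Ψ : (ℤ × ℝ) × (ℤ × ℝ) → ℝ≥0∞} (hΨ : Measurable Ψ) :
    ∫⁻ r, Ψ r ∂freqMeasure.prod freqMeasure =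
      ∑' i : ℤ × ℤ, ∫⁻ t, ∫⁻ t', Ψ ((i.1, t), (i.2, t')) := by
  rw [lintegral_prod _ hΨ.aemeasurable, lintegral_prod _ hΨ.lintegral_prod_right'.aemeasurable,
    lintegral_count, ENNReal.tsum_prod']
  refine tsum_congr fun k => ?_
  have h1 : ∀ t : ℝ, ∫⁻ y, Ψ ((k, t), y) ∂freqMeasure = ∑' k' : ℤ, ∫⁻ t', Ψ ((k, t), (k', t')) := by
    intro t
    rw [lintegral_prod _ (by fun_prop), lintegral_count]
  simp only [h1]
  refine lintegral_tsum fun k' => ?_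
  have h2 : Measurable fun w : ℝ × ℝ => Ψ ((k, w.1), (k', w.2)) := by fun_prop
  exact h2.lintegral_prod_right'.aemeasurable

/-- Two successive convolutions of the weights. The sign `θ` accounts for whether the two free
variables enter the third weight through their sum or through their difference. -/
lemma exists_lintegral_lintegral_decay_le {a b c : ℝ} (h0 : 0 ≤ c) (hb : c ≤ b) (ha : b ≤ a)
    (h1 : 1 < 2 * a - b) (h2 : 1 < a + b - c) :
    ∃ C : ℝ≥0, ∀ θ : ℝ, (θ = 1 ∨ θ = -1) → ∀ x y z : ℝ,
      ∫⁻ t, ∫⁻ t', decay a (t - x) * decay a (t' - y) * decay a (t + θ * t' - z) ≤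
        C * decay c (y - θ * (z - x)) := by
  obtain ⟨C₁, hC₁⟩ := exists_lintegral_decay_mul_decay_le (a := a) (b := a) (c := b)
    (by linarith) ha ha (by linarith)
  obtain ⟨C₂, hC₂⟩ := exists_lintegral_decay_mul_decay_le (a := a) (b := b) (c := c)
    h0 (by linarith) hb h2
  refine ⟨C₁ * C₂, fun θ hθ x y z => ?_⟩
  have hrw : ∀ t' : ℝ, decay b (x - (z - θ * t')) = decay b (t' - θ * (z - x)) := by
    intro t'
    rcases hθ with rfl | rfl
    · congr 1; ring
    · rw [← decay_neg]; congr 1; ring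
  rw [lintegral_lintegral_swap (by fun_prop)]
  calc ∫⁻ t', ∫⁻ t, decay a (t - x) * decay a (t' - y) * decay a (t + θ * t' - z)
      ≤ ∫⁻ t', C₁ * (decay a (t' - y) * decay b (t' - θ * (z - x))) := by
        refine lintegral_mono fun t' => ?_
        calc ∫⁻ t, decay a (t - x) * decay a (t' - y) * decay a (t + θ * t' - z)
            = ∫⁻ t, decay a (t' - y) * (decay a (t - x) * decay a (t - (z - θ * t'))) := by
              refine lintegral_congr fun t => ?_
              rw [show t + θ * t' - z = t - (z - θ * t') by ring]; ring
          _ = decay a (t' - y) * ∫⁻ t, decay a (t - x) * decay a (t - (z - θ * t')) :=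
              lintegral_const_mul _ (by fun_prop)
          _ ≤ decay a (t' - y) * (C₁ * decay b (x - (z - θ * t'))) := by
              gcongr; exact hC₁ _ _
          _ = _ := by rw [hrw]; ring
    _ = C₁ * ∫⁻ t', decay a (t' - y) * decay b (t' - θ * (z - x)) :=
        lintegral_const_mul _ (by fun_prop)
    _ ≤ C₁ * (C₂ * decay c (y - θ * (z - x))) := by gcongr; exact hC₂ _ _
    _ = _ := by push_cast; ring

/-- The square of a kernel in which one of the four variables is frozen: two of the modulations are
free, the third is determined by them, and the phase `P` is the resonance function. -/
lemma exists_lintegral_kernel_le {a b c ρ : ℝ} (h0 : 0 ≤ c) (hb : c ≤ b) (ha : b ≤ a)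
    (h1 : 1 < 2 * a - b) (h2 : 1 < a + b - c) (hρ : 0 < ρ) (hρc : 1 < ρ / 2 + c) :
    ∃ C : ℝ≥0, ∀ (P A B : ℤ × ℤ → ℤ), (∀ i, A i ∣ P i) → (∀ i, B i ∣ P i) →
      Function.Injective (fun i => (A i, B i)) → ∀ (x y z : ℤ × ℤ → ℝ) (θ w : ℝ),
      (θ = 1 ∨ θ = -1) → (∀ i, y i - θ * (z i - x i) = w - 3 * P i) →
      ∀ Ψ : (ℤ × ℝ) × (ℤ × ℝ) → ℝ≥0∞,
        (∀ r, Ψ r = intDecay ρ (P (r.1.1, r.2.1)) * (decay a (r.1.2 - x (r.1.1, r.2.1)) *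
          decay a (r.2.2 - y (r.1.1, r.2.1)) *
          decay a (r.1.2 + θ * r.2.2 - z (r.1.1, r.2.1)))) →
        ∫⁻ r, Ψ r ∂freqMeasure.prod freqMeasure ≤ C := by
  obtain ⟨C₁, hC₁⟩ := exists_lintegral_lintegral_decay_le h0 hb ha h1 h2
  obtain ⟨C₂, hC₂⟩ := exists_tsum_phase_le hρ h0 hρc
  refine ⟨C₁ * C₂, fun P A B hA hB hAB x y z θ w hθ hw Ψ hΨ => ?_⟩
  have hm : ∀ {β : Type} [MeasurableSpace β] (f : ℤ × ℤ → β),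
      Measurable fun r : (ℤ × ℝ) × (ℤ × ℝ) => f (r.1.1, r.2.1) := fun f =>
    (measurable_of_countable f).comp (by fun_prop)
  have hΨm : Measurable Ψ := by
    rw [funext hΨ]
    have e1 := hm (fun i => intDecay ρ (P i))
    have e2 := hm x
    have e3 := hm y
    have e4 := hm z
    fun_prop
  rw [lintegral_freqMeasure_prod hΨm]
  calc ∑' i : ℤ × ℤ, ∫⁻ t, ∫⁻ t', Ψ ((i.1, t), (i.2, t'))
      ≤ ∑' i : ℤ × ℤ, C₁ * (intDecay ρ (P i) * decay c (w - 3 * P i)) := by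
        refine ENNReal.tsum_le_tsum fun i => ?_
        simp only [hΨ]
        have e : ∀ t : ℝ, ∫⁻ t', intDecay ρ (P i) * (decay a (t - x i) * decay a (t' - y i) *
            decay a (t + θ * t' - z i)) = intDecay ρ (P i) * ∫⁻ t', decay a (t - x i) *
              decay a (t' - y i) * decay a (t + θ * t' - z i) := fun t =>
          lintegral_const_mul _ (by fun_prop)
        simp only [e]
        rw [lintegral_const_mul _ (by
          have : Measurable fun s : ℝ × ℝ => decay a (s.1 - x i) * decay a (s.2 - y i) *
            decay a (s.1 + θ * s.2 - z i) := by fun_prop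
          exact this.lintegral_prod_right')]
        calc _ ≤ intDecay ρ (P i) * (C₁ * decay c (y i - θ * (z i - x i))) := by
              gcongr; exact hC₁ θ hθ _ _ _
          _ = _ := by rw [hw]; ring
    _ = C₁ * ∑' i : ℤ × ℤ, intDecay ρ (P i) * decay c (w - 3 * P i) := ENNReal.tsum_mul_left
    _ ≤ _ := by push_cast; gcongr; exact hC₂ P A B hA hB hAB w

lemma sq_decay (a x : ℝ) : decay (a / 2) x ^ 2 = decay a x := by
  rw [sq, decay_mul]; ring_nf

lemma intDecay_mul (a b : ℝ) (n : ℤ) : intDecay a n * intDecay b n = intDecay (a + b) n := by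
  unfold intDecay
  split_ifs with hn
  · simp
  have hn' : 0 < |(n : ℝ)| := by simpa using hn
  rw [← ENNReal.ofReal_mul (by positivity), ← Real.rpow_add hn', neg_add]

lemma sq_intDecay (a : ℝ) (n : ℤ) : intDecay (a / 2) n ^ 2 = intDecay a n := by
  rw [sq, intDecay_mul]; ring_nf

/-- A modulation `x` that dominates the integer `n` yields decay in `n`. -/
lemma decay_le_of_le_modulation {a x : ℝ} {n : ℤ} (hn : n ≠ 0) (ha : 0 ≤ a)
    (h : |(n : ℝ)| ≤ 2 * |x|) : decay a x ≤ ENNReal.ofReal (2 ^ a) * intDecay a n := by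
  have hn' : 0 < |(n : ℝ)| := by simpa using hn
  unfold decay intDecay
  rw [if_neg hn, ← ENNReal.ofReal_mul (by positivity)]
  refine ENNReal.ofReal_le_ofReal ?_
  calc bracket x ^ (-a) ≤ (|(n : ℝ)| / 2) ^ (-a) :=
        Real.rpow_le_rpow_of_nonpos (by positivity) (by unfold bracket; linarith) (by linarith)
    _ = _ := by
        rw [Real.div_rpow hn'.le (by norm_num), Real.rpow_neg (by norm_num : (0:ℝ) ≤ 2)]
        field_simp

/-- The largest of the four modulations is at least comparable to the resonance function, and pays
for it. -/
lemma kernel_le_sum {a e : ℝ} (ha : 0 ≤ a) (x y z : ℤ × ℝ) :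
    intDecay e (resonance x.1 y.1 z.1) * (decay a (modulation (x + y + z)) *
      decay a (modulation x) * decay a (modulation y) * decay a (modulation z)) ≤
    ENNReal.ofReal (2 ^ a) * (
      intDecay (e + a) (resonance x.1 y.1 z.1) *
        (decay a (modulation x) * decay a (modulation y) * decay a (modulation z)) +
      intDecay (e + a) (resonance x.1 y.1 z.1) *
        (decay a (modulation (x + y + z)) * decay a (modulation y) * decay a (modulation z)) +
      intDecay (e + a) (resonance x.1 y.1 z.1) *
        (decay a (modulation (x + y + z)) * decay a (modulation x) * decay a (modulation z)) +
      intDecay (e + a) (resonance x.1 y.1 z.1) *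
        (decay a (modulation (x + y + z)) * decay a (modulation x) * decay a (modulation y))) := by
  have hid := modulation_add_add x y z
  set R := resonance x.1 y.1 z.1
  set s₀ := modulation (x + y + z)
  set s₁ := modulation x
  set s₂ := modulation y
  set s₃ := modulation z
  by_cases hR : R = 0
  · simp [hR, intDecay]
  have h3 : 3 * |(R : ℝ)| ≤ |s₀| + |s₁| + |s₂| + |s₃| := by
    have e : 3 * (R : ℝ) = s₁ + s₂ + s₃ - s₀ := by linarith
    calc 3 * |(R : ℝ)| = |3 * (R : ℝ)| := by rw [abs_mul]; norm_num
      _ = |s₁ + s₂ + s₃ - s₀| := by rw [e]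
      _ ≤ |s₁ + s₂ + s₃| + |s₀| := abs_sub _ _
      _ ≤ _ := by linarith [abs_add_three s₁ s₂ s₃]
  -- One of the four modulations is at least `3|R| / 4`.
  have hcase : |(R : ℝ)| ≤ 2 * |s₀| ∨ |(R : ℝ)| ≤ 2 * |s₁| ∨ |(R : ℝ)| ≤ 2 * |s₂| ∨
      |(R : ℝ)| ≤ 2 * |s₃| := by
    by_contra! hcon
    linarith [abs_nonneg s₀, abs_nonneg s₁, abs_nonneg s₂, abs_nonneg s₃, hcon.1, hcon.2.1,
      hcon.2.2.1, hcon.2.2.2, abs_nonneg (R : ℝ)]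
  rw [← intDecay_mul]
  rcases hcase with h | h | h | h
  · calc _ ≤ intDecay e R * ((ENNReal.ofReal (2 ^ a) * intDecay a R) *
          decay a s₁ * decay a s₂ * decay a s₃) := by
          gcongr; exact decay_le_of_le_modulation hR ha h
      _ = ENNReal.ofReal (2 ^ a) * (intDecay e R * intDecay a R *
          (decay a s₁ * decay a s₂ * decay a s₃)) := by ring
      _ ≤ _ := by gcongr; rw [add_assoc, add_assoc]; exact le_self_add
  · calc _ ≤ intDecay e R * (decay a s₀ * (ENNReal.ofReal (2 ^ a) * intDecay a R) *
          decay a s₂ * decay a s₃) := by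
          gcongr; exact decay_le_of_le_modulation hR ha h
      _ = ENNReal.ofReal (2 ^ a) * (intDecay e R * intDecay a R *
          (decay a s₀ * decay a s₂ * decay a s₃)) := by ring
      _ ≤ _ := by gcongr; rw [add_assoc, add_assoc]; exact le_add_left le_self_add
  · calc _ ≤ intDecay e R * (decay a s₀ * decay a s₁ * (ENNReal.ofReal (2 ^ a) * intDecay a R) *
          decay a s₃) := by
          gcongr; exact decay_le_of_le_modulation hR ha h
      _ = ENNReal.ofReal (2 ^ a) * (intDecay e R * intDecay a R *
          (decay a s₀ * decay a s₁ * decay a s₃)) := by ring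
      _ ≤ _ := by gcongr; rw [add_assoc]; exact le_add_left le_self_add
  · calc _ ≤ intDecay e R * (decay a s₀ * decay a s₁ * decay a s₂ *
          (ENNReal.ofReal (2 ^ a) * intDecay a R)) := by
          gcongr; exact decay_le_of_le_modulation hR ha h
      _ = ENNReal.ofReal (2 ^ a) * (intDecay e R * intDecay a R *
          (decay a s₀ * decay a s₁ * decay a s₂)) := by ring
      _ ≤ _ := by gcongr; exact le_add_self

instance : freqMeasure.IsNegInvariant := by
  constructor
  have h1 : (Measure.count : Measure ℤ).map (fun k => -k) = Measure.count := by
    ext A hA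
    rw [Measure.map_apply measurable_neg hA, Measure.count_apply (measurable_neg hA),
      Measure.count_apply hA]
    exact congrArg _ (Set.encard_preimage_of_bijective (neg_involutive.bijective) A)
  have h2 : (volume : Measure ℝ).map (fun t => -t) = volume := Measure.map_neg_eq_self volume
  have h3 := Measure.map_prod_map (Measure.count : Measure ℤ) (volume : Measure ℝ)
    (measurable_neg : Measurable fun k : ℤ => -k) (measurable_neg : Measurable fun t : ℝ => -t)
  rw [h1, h2] at h3
  exact h3.symm

/-- The coefficients of the cubic term in absolute value, at output frequency `k` and input
frequencies `k - k₂ - k₃`, `k₂`, `k₃`. -/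
def cubicKernel (k k₂ k₃ : ℤ) : ℝ≥0∞ :=
  if k - k₂ - k₃ ≠ 0 ∧ resonance (k - k₂ - k₃) k₂ k₃ ≠ 0 then
    ENNReal.ofReal (|((k - k₂ - k₃ : ℤ) : ℝ)|⁻¹) else 0

/-- The cubic term on the Fourier side, with absolute values. -/
def trilinear (F G H : ℤ × ℝ → ℝ≥0∞) (p : ℤ × ℝ) : ℝ≥0∞ :=
  ∫⁻ r : (ℤ × ℝ) × (ℤ × ℝ), cubicKernel p.1 r.1.1 r.2.1 * (F (p - r.1 - r.2) * G r.1 * H r.2)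
    ∂freqMeasure.prod freqMeasure

/-- The weight `⟨k⟩^s ⟨τ - k³⟩^b`. -/
def weight (s b : ℝ) (p : ℤ × ℝ) : ℝ≥0∞ := decay (-s) p.1 * decay (-b) (modulation p)

lemma measurable_intCast_real : Measurable (fun k : ℤ => (k : ℝ)) := measurable_of_countable _

@[fun_prop]
lemma measurable_weight (s b : ℝ) : Measurable (weight s b) := by
  unfold weight
  have := measurable_intCast_real
  fun_prop

lemma weight_mul_weight (s b s' b' : ℝ) (p : ℤ × ℝ) :
    weight s b p * weight s' b' p = weight (s + s') (b + b') p := by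
  unfold weight
  rw [show decay (-s) (p.1 : ℝ) * decay (-b) (modulation p) *
      (decay (-s') (p.1 : ℝ) * decay (-b') (modulation p)) =
      (decay (-s) (p.1 : ℝ) * decay (-s') (p.1 : ℝ)) *
      (decay (-b) (modulation p) * decay (-b') (modulation p)) by ring, decay_mul, decay_mul]
  ring_nf

lemma weight_neg_mul_weight (s b : ℝ) (p : ℤ × ℝ) : weight (-s) (-b) p * weight s b p = 1 := by
  rw [weight_mul_weight]; simp [weight, decay_zero]

lemma weight_ne_top (s b : ℝ) (p : ℤ × ℝ) : weight s b p ≠ ⊤ :=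
  ENNReal.mul_ne_top (decay_ne_top _ _) (decay_ne_top _ _)

lemma cubicKernel_le (k₁ k₂ k₃ : ℤ) :
    cubicKernel (k₁ + k₂ + k₃) k₂ k₃ ≤
      if resonance k₁ k₂ k₃ ≠ 0 then 2 * decay 1 k₁ else 0 := by
  unfold cubicKernel
  rw [show k₁ + k₂ + k₃ - k₂ - k₃ = k₁ by ring]
  by_cases h1 : k₁ = 0
  · simp [h1]
  by_cases h2 : resonance k₁ k₂ k₃ = 0
  · simp [h2]
  simp only [ne_eq, h1, not_false_eq_true, h2, and_self, if_true]
  unfold decay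
  rw [show (2 : ℝ≥0∞) = ENNReal.ofReal 2 by simp, ← ENNReal.ofReal_mul (by norm_num)]
  refine ENNReal.ofReal_le_ofReal ?_
  have h3 : 1 ≤ |(k₁ : ℝ)| := by exact_mod_cast Int.one_le_abs h1
  rw [Real.rpow_neg_one, inv_le_comm₀ (by linarith) (by have := bracket_pos k₁; positivity),
    mul_inv, inv_inv]
  unfold bracket; linarith

lemma measurable_kernel {a : ℝ} {c : ℝ≥0∞} {f : (ℤ × ℝ) → (ℤ × ℝ) → (ℤ × ℝ) → ℝ≥0∞}
    (hf : Measurable fun q : (ℤ × ℝ) × (ℤ × ℝ) × (ℤ × ℝ) => f q.1 q.2.1 q.2.2) :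
    Measurable fun q : (ℤ × ℝ) × (ℤ × ℝ) × (ℤ × ℝ) =>
      c * (intDecay a (resonance (q.1 - q.2.1 - q.2.2).1 q.2.1.1 q.2.2.1) * f q.1 q.2.1 q.2.2) := by
  have h1 : Measurable fun q : (ℤ × ℝ) × (ℤ × ℝ) × (ℤ × ℝ) =>
      intDecay a (resonance (q.1 - q.2.1 - q.2.2).1 q.2.1.1 q.2.2.1) :=
    (measurable_of_countable (fun i : ℤ × ℤ × ℤ => intDecay a (resonance (i.1 - i.2.1 - i.2.2)
      i.2.1 i.2.2))).comp (g := _) (f := fun q : (ℤ × ℝ) × (ℤ × ℝ) × (ℤ × ℝ) =>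
        (q.1.1, q.2.1.1, q.2.2.1)) (by fun_prop)
  fun_prop

/-- The cubic term with the model kernel, which is symmetric in the four modulations. Replacing the
largest modulation by the resonance function leaves four kernels, and each of them is square
integrable uniformly in the variable whose modulation has been used up. -/
lemma exists_lintegral_sq_model_le {η ε : ℝ} (hη1 : η ≤ 1) (hε : 0 < ε)
    (hεη : 20 * ε < η) :
    ∃ C : ℝ≥0, ∀ F G H : ℤ × ℝ → ℝ≥0∞, Measurable F → Measurable G → Measurable H →
      ∫⁻ p, (∫⁻ r : (ℤ × ℝ) × (ℤ × ℝ),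
        intDecay (-((1 - η) / 2)) (resonance (p - r.1 - r.2).1 r.1.1 r.2.1) *
          (decay (1 / 2 - ε) (modulation p) * decay (1 / 2 - ε) (modulation (p - r.1 - r.2)) *
            decay (1 / 2 - ε) (modulation r.1) * decay (1 / 2 - ε) (modulation r.2)) *
        (F (p - r.1 - r.2) * G r.1 * H r.2) ∂freqMeasure.prod freqMeasure) ^ 2 ∂freqMeasure ≤
      C * ((∫⁻ p, F p ^ 2 ∂freqMeasure) * (∫⁻ p, G p ^ 2 ∂freqMeasure) *
        ∫⁻ p, H p ^ 2 ∂freqMeasure) := by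
  -- With these exponents each of the two convolutions in time loses exactly `1 + ε` powers of decay,
  -- and the final sum converges because `(η - 2ε) / 2 + (1 - 8ε) > 1`.
  obtain ⟨C, hC⟩ := exists_lintegral_kernel_le (a := 1 - 2 * ε) (b := 1 - 5 * ε) (c := 1 - 8 * ε)
    (ρ := η - 2 * ε) (by linarith) (by linarith) (by linarith) (by linarith) (by linarith)
    (by linarith) (by linarith)
  set a : ℝ := 1 / 2 - ε with ha
  have ha2 : a = (1 - 2 * ε) / 2 := by rw [ha]; ring
  have hea : -((1 - η) / 2) + a = (η - 2 * ε) / 2 := by rw [ha]; ring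
  set c : ℝ≥0∞ := ENNReal.ofReal (2 ^ a) with hc
  have hct : c ^ 2 ≠ ⊤ := by simp [hc]
  have hB : 16 * (c ^ 2 * C) ≠ ⊤ := by finiteness
  refine ⟨(16 * (c ^ 2 * C)).toNNReal, fun F G H hF hG hH => ?_⟩
  rw [ENNReal.coe_toNNReal hB]
  have hsq : ∀ (n : ℤ) (u v w : ℝ), (c * (intDecay ((η - 2 * ε) / 2) n *
      (decay a u * decay a v * decay a w))) ^ 2 = c ^ 2 * (intDecay (η - 2 * ε) n *
      (decay (1 - 2 * ε) u * decay (1 - 2 * ε) v * decay (1 - 2 * ε) w)) := by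
    intro n u v w
    simp only [mul_pow, ha2, sq_intDecay, sq_decay]
  refine lintegral_sq_trilinear_le freqMeasure (B := c ^ 2 * C)
    (M := fun p y z => intDecay (-((1 - η) / 2)) (resonance (p - y - z).1 y.1 z.1) *
      (decay a (modulation p) * decay a (modulation (p - y - z)) *
        decay a (modulation y) * decay a (modulation z)))
    (M₀ := fun p y z => c * (intDecay ((η - 2 * ε) / 2) (resonance (p - y - z).1 y.1 z.1) *
      (decay a (modulation (p - y - z)) * decay a (modulation y) * decay a (modulation z))))
    (M₁ := fun p y z => c * (intDecay ((η - 2 * ε) / 2) (resonance (p - y - z).1 y.1 z.1) *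
      (decay a (modulation p) * decay a (modulation y) * decay a (modulation z))))
    (M₂ := fun p y z => c * (intDecay ((η - 2 * ε) / 2) (resonance (p - y - z).1 y.1 z.1) *
      (decay a (modulation p) * decay a (modulation (p - y - z)) * decay a (modulation z))))
    (M₃ := fun p y z => c * (intDecay ((η - 2 * ε) / 2) (resonance (p - y - z).1 y.1 z.1) *
      (decay a (modulation p) * decay a (modulation (p - y - z)) * decay a (modulation y))))
    ?_ ?_ ?_ ?_ ?_ ?_ ?_ ?_ ?_ ?_ hF hG hH
  · simpa using measurable_kernel (a := -((1 - η) / 2)) (c := 1)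
      (f := fun p y z => decay a (modulation p) * decay a (modulation (p - y - z)) *
        decay a (modulation y) * decay a (modulation z)) (by fun_prop)
  · exact measurable_kernel (f := fun p y z => decay a (modulation (p - y - z)) *
      decay a (modulation y) * decay a (modulation z)) (by fun_prop)
  · exact measurable_kernel (f := fun p y z => decay a (modulation p) *
      decay a (modulation y) * decay a (modulation z)) (by fun_prop)
  · exact measurable_kernel (f := fun p y z => decay a (modulation p) *
      decay a (modulation (p - y - z)) * decay a (modulation z)) (by fun_prop)
  · exact measurable_kernel (f := fun p y z => decay a (modulation p) *
      decay a (modulation (p - y - z)) * decay a (modulation y)) (by fun_prop)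
  · intro p y z
    have := kernel_le_sum (a := a) (e := -((1 - η) / 2)) (by linarith) (p - y - z) y z
    rw [show p - y - z + y + z = p by abel, hea] at this
    refine this.trans (le_of_eq ?_)
    ring
  · intro p
    simp only [hsq]
    rw [lintegral_const_mul' _ _ hct]
    gcongr
    refine hC (fun i => resonance (p.1 - i.1 - i.2) i.1 i.2) (fun i => p.1 - i.2)
      (fun i => p.1 - i.1) (fun i => ⟨(i.1 + i.2) * (p.1 - i.1), by unfold resonance; ring⟩)
      (fun i => ⟨(p.1 - i.2) * (i.1 + i.2), by unfold resonance; ring⟩)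
      (fun i j hij => by
        simp only [Prod.mk.injEq] at hij
        exact Prod.ext (by linarith [hij.2]) (by linarith [hij.1]))
      (fun i => (i.1 : ℝ) ^ 3) (fun i => (i.2 : ℝ) ^ 3)
      (fun i => p.2 - ((p.1 - i.1 - i.2 : ℤ) : ℝ) ^ 3) 1 (-modulation p) (Or.inl rfl)
      (fun i => by simp only [modulation, resonance]; push_cast; ring) _ (fun r => ?_)
    simp only [modulation, Prod.fst_sub, Prod.snd_sub, one_mul]
    rw [decay_sub_comm _ (p.2 - r.1.2 - r.2.2),
      show ((p.1 - r.1.1 - r.2.1 : ℤ) : ℝ) ^ 3 - (p.2 - r.1.2 - r.2.2) =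
        r.1.2 + r.2.2 - (p.2 - ((p.1 - r.1.1 - r.2.1 : ℤ) : ℝ) ^ 3) by ring]
    ring
  · intro x
    simp only [hsq]
    rw [lintegral_const_mul' _ _ hct]
    gcongr
    refine hC (fun i => resonance x.1 i.1 i.2) (fun i => x.1 + i.1)
      (fun i => x.1 + i.2) (fun i => ⟨(i.1 + i.2) * (x.1 + i.2), by unfold resonance; ring⟩)
      (fun i => ⟨(x.1 + i.1) * (i.1 + i.2), by unfold resonance; ring⟩)
      (fun i j hij => by
        simp only [Prod.mk.injEq] at hij
        exact Prod.ext (by linarith [hij.1]) (by linarith [hij.2]))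
      (fun i => (i.1 : ℝ) ^ 3) (fun i => (i.2 : ℝ) ^ 3)
      (fun i => ((x.1 + i.1 + i.2 : ℤ) : ℝ) ^ 3 - x.2) 1 (modulation x) (Or.inl rfl)
      (fun i => by simp only [modulation, resonance]; push_cast; ring) _ (fun r => ?_)
    rw [show x + r.1 + r.2 - r.1 - r.2 = x by abel]
    simp only [modulation, Prod.fst_add, Prod.snd_add, one_mul]
    rw [show x.2 + r.1.2 + r.2.2 - ((x.1 + r.1.1 + r.2.1 : ℤ) : ℝ) ^ 3 =
        r.1.2 + r.2.2 - (((x.1 + r.1.1 + r.2.1 : ℤ) : ℝ) ^ 3 - x.2) by ring]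
    ring
  · intro y
    simp only [hsq]
    rw [lintegral_const_mul' _ _ hct]
    gcongr
    refine hC (fun i => resonance (i.1 - y.1 - i.2) y.1 i.2) (fun i => y.1 + i.2)
      (fun i => i.1 - y.1) (fun i => ⟨(i.1 - i.2) * (i.1 - y.1), by unfold resonance; ring⟩)
      (fun i => ⟨(i.1 - i.2) * (y.1 + i.2), by unfold resonance; ring⟩)
      (fun i j hij => by
        simp only [Prod.mk.injEq] at hij
        exact Prod.ext (by linarith [hij.2]) (by linarith [hij.1]))
      (fun i => (i.1 : ℝ) ^ 3) (fun i => (i.2 : ℝ) ^ 3)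
      (fun i => y.2 + ((i.1 - y.1 - i.2 : ℤ) : ℝ) ^ 3) (-1) (modulation y) (Or.inr rfl)
      (fun i => by simp only [modulation, resonance]; push_cast; ring) _ (fun r => ?_)
    simp only [modulation, Prod.fst_sub, Prod.snd_sub]
    rw [show r.1.2 - y.2 - r.2.2 - ((r.1.1 - y.1 - r.2.1 : ℤ) : ℝ) ^ 3 =
        r.1.2 + -1 * r.2.2 - (y.2 + ((r.1.1 - y.1 - r.2.1 : ℤ) : ℝ) ^ 3) by ring]
    ring
  · intro z
    simp only [hsq]
    rw [lintegral_const_mul' _ _ hct]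
    gcongr
    refine hC (fun i => resonance (i.1 - i.2 - z.1) i.2 z.1) (fun i => i.2 + z.1)
      (fun i => i.1 - z.1) (fun i => ⟨(i.1 - z.1) * (i.1 - i.2), by unfold resonance; ring⟩)
      (fun i => ⟨(i.2 + z.1) * (i.1 - i.2), by unfold resonance; ring⟩)
      (fun i j hij => by
        simp only [Prod.mk.injEq] at hij
        exact Prod.ext (by linarith [hij.2]) (by linarith [hij.1]))
      (fun i => (i.1 : ℝ) ^ 3) (fun i => (i.2 : ℝ) ^ 3)
      (fun i => z.2 + ((i.1 - i.2 - z.1 : ℤ) : ℝ) ^ 3) (-1) (modulation z) (Or.inr rfl)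
      (fun i => by simp only [modulation, resonance]; push_cast; ring) _ (fun r => ?_)
    simp only [modulation, Prod.fst_sub, Prod.snd_sub]
    rw [show r.1.2 - r.2.2 - z.2 - ((r.1.1 - r.2.1 - z.1 : ℤ) : ℝ) ^ 3 =
        r.1.2 + -1 * r.2.2 - (z.2 + ((r.1.1 - r.2.1 - z.1 : ℤ) : ℝ) ^ 3) by ring]
    ring

/-- The cubic estimate on the Fourier side. The gain `η` over the critical power of the resonance
function bounds the admissible `ε`; the weights `⟨τ - k³⟩^{1/2}` of the inputs are used only to the
power `1/2 - ε`. -/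
lemma exists_lintegral_sq_trilinear_le {s s₁ : ℝ} (hs : -(1 / 2 : ℝ) < s)
    (hs₁ : s₁ < min (s + 1) (3 * s + 1)) :
    ∃ ε₀ : ℝ, 0 < ε₀ ∧ ∀ ε : ℝ, 0 < ε → ε < ε₀ → ∃ C : ℝ≥0,
      ∀ F G H : ℤ × ℝ → ℝ≥0∞, Measurable F → Measurable G → Measurable H →
        ∫⁻ p, (weight s₁ (-(1 / 2) + ε) p * trilinear F G H p) ^ 2 ∂freqMeasure ≤
          C * ((∫⁻ p, (weight s (1 / 2) p * F p) ^ 2 ∂freqMeasure) *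
            (∫⁻ p, (weight s (1 / 2) p * G p) ^ 2 ∂freqMeasure) *
            ∫⁻ p, (weight s (1 / 2) p * H p) ^ 2 ∂freqMeasure) := by
  obtain ⟨η, hη, hη1, D, hD⟩ := exists_multiplier_le hs hs₁
  refine ⟨η / 20, by linarith, fun ε hε hεη => ?_⟩
  obtain ⟨C, hC⟩ := exists_lintegral_sq_model_le hη1 hε (by linarith)
  refine ⟨(2 * D) ^ 2 * C, fun F G H hF hG hH => ?_⟩
  set a : ℝ := 1 / 2 - ε with ha
  set W : ℤ × ℝ → ℝ≥0∞ := weight s (1 / 2) with hW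
  have hker : ∀ x y z : ℤ × ℝ,
      weight s₁ (-(1 / 2) + ε) (x + y + z) * cubicKernel (x + y + z).1 y.1 z.1 *
        (weight (-s) (-(1 / 2)) x * weight (-s) (-(1 / 2)) y * weight (-s) (-(1 / 2)) z) ≤
      (2 * D) * (intDecay (-((1 - η) / 2)) (resonance x.1 y.1 z.1) *
          (decay a (modulation (x + y + z)) * decay a (modulation x) *
            decay a (modulation y) * decay a (modulation z))) := by
    intro x y z
    have h1 := cubicKernel_le x.1 y.1 z.1
    by_cases hR : resonance x.1 y.1 z.1 = 0
    · rw [hR] at h1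
      simp only [ne_eq, not_true_eq_false, if_false, nonpos_iff_eq_zero] at h1
      simp [Prod.fst_add, h1]
    rw [if_pos hR] at h1
    have hb : ∀ u : ℝ, decay (1 / 2) u ≤ decay a u := decay_anti (by linarith)
    have h2 := hD x.1 y.1 z.1 hR
    unfold weight
    simp only [neg_neg, Prod.fst_add]
    rw [show -(-(1 / 2) + ε) = a by rw [ha]; ring]
    calc _ ≤ decay (-s₁) ((x.1 + y.1 + z.1 : ℤ) : ℝ) * decay a (modulation (x + y + z)) *
          (2 * decay 1 x.1) * ((decay s x.1 * decay a (modulation x)) *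
          (decay s y.1 * decay a (modulation y)) * (decay s z.1 * decay a (modulation z))) := by
          gcongr <;> exact hb _
      _ = 2 * (decay (-s₁) ((x.1 + y.1 + z.1 : ℤ) : ℝ) * (decay s x.1 * decay 1 x.1) *
          decay s y.1 * decay s z.1) * (decay a (modulation (x + y + z)) *
            decay a (modulation x) * decay a (modulation y) * decay a (modulation z)) := by ring
      _ ≤ 2 * (D * intDecay (-((1 - η) / 2)) (resonance x.1 y.1 z.1)) *
          (decay a (modulation (x + y + z)) *
            decay a (modulation x) * decay a (modulation y) * decay a (modulation z)) := by
          rw [decay_mul]; gcongr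
      _ = _ := by ring
  have hpt : ∀ p, weight s₁ (-(1 / 2) + ε) p * trilinear F G H p ≤ (2 * D) *
      ∫⁻ r : (ℤ × ℝ) × (ℤ × ℝ),
        intDecay (-((1 - η) / 2)) (resonance (p - r.1 - r.2).1 r.1.1 r.2.1) *
          (decay a (modulation p) * decay a (modulation (p - r.1 - r.2)) *
            decay a (modulation r.1) * decay a (modulation r.2)) *
        ((W (p - r.1 - r.2) * F (p - r.1 - r.2)) * (W r.1 * G r.1) * (W r.2 * H r.2))
          ∂freqMeasure.prod freqMeasure := by
    intro p
    unfold trilinear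
    rw [← lintegral_const_mul' _ _ (weight_ne_top _ _ _),
      ← lintegral_const_mul' _ _ (by finiteness)]
    refine lintegral_mono fun r => ?_
    have h1 := hker (p - r.1 - r.2) r.1 r.2
    rw [show p - r.1 - r.2 + r.1 + r.2 = p by abel] at h1
    have e : ∀ q, weight (-s) (-(1 / 2)) q * W q = 1 := fun q => weight_neg_mul_weight s (1 / 2) q
    calc weight s₁ (-(1 / 2) + ε) p * (cubicKernel p.1 r.1.1 r.2.1 *
          (F (p - r.1 - r.2) * G r.1 * H r.2))
        = weight s₁ (-(1 / 2) + ε) p * cubicKernel p.1 r.1.1 r.2.1 *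
          ((weight (-s) (-(1 / 2)) (p - r.1 - r.2) * W (p - r.1 - r.2)) *
          (weight (-s) (-(1 / 2)) r.1 * W r.1) * (weight (-s) (-(1 / 2)) r.2 * W r.2)) *
          (F (p - r.1 - r.2) * G r.1 * H r.2) := by
          rw [e, e, e]; ring
      _ = weight s₁ (-(1 / 2) + ε) p * cubicKernel p.1 r.1.1 r.2.1 *
          (weight (-s) (-(1 / 2)) (p - r.1 - r.2) * weight (-s) (-(1 / 2)) r.1 *
            weight (-s) (-(1 / 2)) r.2) * ((W (p - r.1 - r.2) * F (p - r.1 - r.2)) *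
            (W r.1 * G r.1) * (W r.2 * H r.2)) := by ring
      _ ≤ _ := by
          refine (mul_le_mul_left h1 _).trans (le_of_eq ?_)
          ring
  calc ∫⁻ p, (weight s₁ (-(1 / 2) + ε) p * trilinear F G H p) ^ 2 ∂freqMeasure
      ≤ ∫⁻ p, _ ∂freqMeasure := lintegral_mono fun p => pow_le_pow_left₀ (by positivity) (hpt p) 2
    _ ≤ _ := by
        simp only [mul_pow (2 * (D : ℝ≥0∞))]
        rw [lintegral_const_mul' _ _ (by finiteness)]
        push_cast
        rw [mul_assoc]
        gcongr
        exact hC (fun p => W p * F p) (fun p => W p * G p) (fun p => W p * H p)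
          (by fun_prop) (by fun_prop) (by fun_prop)

/-! ### The Fourier transform in time -/

open FourierTransform
open scoped ContDiff

/-- The function `τ ↦ ∫ e^{itτ} ψ(t) dt`. -/
def expTransform (ψ : ℝ → ℂ) (τ : ℝ) : ℂ := ∫ t : ℝ, Complex.exp (Complex.I * t * τ) * ψ t

lemma norm_exp_I_mul_mul (t τ : ℝ) : ‖Complex.exp (Complex.I * t * τ)‖ = 1 := by
  rw [mul_assoc, mul_comm, ← Complex.ofReal_mul]
  exact Complex.norm_exp_ofReal_mul_I _

lemma fourier_eq_expTransform (ψ : ℝ → ℂ) (ξ : ℝ) : 𝓕 ψ ξ = expTransform ψ (-2 * Real.pi * ξ) := by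
  rw [Real.fourier_real_eq_integral_exp_smul]
  unfold expTransform
  refine integral_congr_ae (Filter.Eventually.of_forall fun t => ?_)
  simp only [smul_eq_mul]
  congr 2
  push_cast; ring

/-- The dilation `ξ ↦ -(2π)⁻¹ ξ`, which relates the two normalizations of the Fourier transform. -/
def dilation : ℝ ≃L[ℝ] ℝ :=
  ContinuousLinearEquiv.unitsEquivAut ℝ
    (Units.mk0 (-(2 * Real.pi)⁻¹) (by have := Real.pi_pos; simp [this.ne']))

lemma dilation_apply (x : ℝ) : dilation x = -(2 * Real.pi)⁻¹ * x := by
  simp [dilation, ContinuousLinearEquiv.unitsEquivAut, mul_comm]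

/-- The transform `φ ↦ ∫ e^{itτ} φ(t) dt` on Schwartz functions. -/
def timeTransform : 𝓢(ℝ, ℂ) →L[ℂ] 𝓢(ℝ, ℂ) :=
  (SchwartzMap.compCLMOfContinuousLinearEquiv ℂ dilation) ∘L (fourierCLM ℂ 𝓢(ℝ, ℂ))

lemma timeTransform_apply (φ : 𝓢(ℝ, ℂ)) (τ : ℝ) : timeTransform φ τ = expTransform φ τ := by
  have h1 : timeTransform φ τ = 𝓕 (φ : ℝ → ℂ) (dilation τ) := rfl
  rw [h1, fourier_eq_expTransform, dilation_apply]
  congr 1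
  have := Real.pi_pos
  field_simp

lemma fourier_eq_timeTransform (φ : 𝓢(ℝ, ℂ)) (ξ : ℝ) :
    (𝓕 φ : 𝓢(ℝ, ℂ)) ξ = timeTransform φ (-2 * Real.pi * ξ) := by
  rw [timeTransform_apply, ← fourier_eq_expTransform]; rfl

lemma continuous_expTransform {ψ : ℝ → ℂ} (hψ : Integrable ψ) : Continuous (expTransform ψ) := by
  refine continuous_of_dominated (bound := fun t => ‖ψ t‖) (fun τ => ?_)
    (fun τ => Filter.Eventually.of_forall fun t => ?_) hψ.norm
    (Filter.Eventually.of_forall fun t => by fun_prop)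
  · have : Continuous fun t : ℝ => Complex.exp (Complex.I * t * τ) := by fun_prop
    exact this.aestronglyMeasurable.mul hψ.1
  · rw [norm_mul, norm_exp_I_mul_mul, one_mul]

/-- Two locally integrable functions with the same pairings against Schwartz functions agree. -/
lemma ae_eq_of_forall_integral_mul_schwartz {f g : ℝ → ℂ} (hf : LocallyIntegrable f)
    (hg : LocallyIntegrable g) (h : ∀ φ : 𝓢(ℝ, ℂ), ∫ t, f t * φ t = ∫ t, g t * φ t) :
    f =ᵐ[volume] g := by
  refine ae_eq_of_integral_contDiff_smul_eq hf hg fun θ hθ hc => ?_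
  have hc' : HasCompactSupport (Complex.ofRealCLM ∘ θ) := hc.comp_left rfl
  have hθ' : ContDiff ℝ ∞ (Complex.ofRealCLM ∘ θ) := by fun_prop
  have := h (hc'.toSchwartzMap hθ')
  simpa [mul_comm] using this

lemma locallyIntegrable_of_memLp_two {f : ℝ → ℂ} (hf : MemLp f 2) : LocallyIntegrable f volume :=
  hf.locallyIntegrable (by norm_num)

/-- The Fourier transform on `L²` is symmetric for the bilinear pairing. -/
lemma integral_fourier_mul_Lp (f g : Lp ℂ 2 (volume : Measure ℝ)) :
    ∫ x, (𝓕 f : Lp ℂ 2 (volume : Measure ℝ)) x * g x =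
      ∫ x, f x * (𝓕 g : Lp ℂ 2 (volume : Measure ℝ)) x := by
  let L := (ContinuousLinearMap.mul ℂ ℂ).lpPairing (volume : Measure ℝ) 2 2
  have hL : ∀ a b : Lp ℂ 2 (volume : Measure ℝ), L a b = ∫ x, a x * b x := fun a b => by
    simp [L, ContinuousLinearMap.lpPairing_eq_integral]
  rw [← hL, ← hL]
  refine DenseRange.induction_on (p := fun f : Lp ℂ 2 (volume : Measure ℝ) => L (𝓕 f) g = L f (𝓕 g))
    (SchwartzMap.denseRange_toLpCLM (E := ℝ) (F := ℂ) (p := 2) (μ := volume)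
      ENNReal.ofNat_ne_top) f ?_ ?_
  · refine isClosed_eq ?_ ?_
    · exact (L.flip g).continuous.comp (Lp.fourierTransformₗᵢ ℝ ℂ).continuous
    · exact (L.flip (𝓕 g)).continuous
  · intro φ
    have h1 := DFunLike.congr_fun (Lp.fourier_toTemperedDistribution_eq g) φ
    rw [TemperedDistribution.fourier_apply, Lp.toTemperedDistribution_apply,
      Lp.toTemperedDistribution_apply] at h1
    simp only [smul_eq_mul] at h1
    rw [SchwartzMap.toLpCLM_apply, SchwartzMap.toLp_fourier_eq, hL, hL]
    calc _ = ∫ x, (𝓕 φ : 𝓢(ℝ, ℂ)) x * g x := by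
          refine integral_congr_ae ?_
          filter_upwards [(𝓕 φ : 𝓢(ℝ, ℂ)).coeFn_toLp 2 volume] with x hx
          rw [hx]
      _ = _ := h1
      _ = _ := by
          refine integral_congr_ae ?_
          filter_upwards [φ.coeFn_toLp 2 volume] with x hx
          rw [hx]

lemma integral_mul_fourier_Lp (u : Lp ℂ 2 (volume : Measure ℝ)) (φ : 𝓢(ℝ, ℂ)) :
    ∫ x, (𝓕 u : Lp ℂ 2 (volume : Measure ℝ)) x * φ x = ∫ x, u x * (𝓕 φ : 𝓢(ℝ, ℂ)) x := by
  have e1 := DFunLike.congr_fun (Lp.fourier_toTemperedDistribution_eq u) φ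
  rw [TemperedDistribution.fourier_apply, Lp.toTemperedDistribution_apply,
    Lp.toTemperedDistribution_apply] at e1
  simp only [smul_eq_mul] at e1
  simp only [mul_comm ((𝓕 u : Lp ℂ 2 (volume : Measure ℝ)) _), mul_comm (u _)]
  exact e1.symm

/-- On `L¹ ∩ L²` the `L²` Fourier transform is given by the integral. -/
lemma fourier_Lp_ae_eq {ψ : ℝ → ℂ} {u : Lp ℂ 2 (volume : Measure ℝ)} (h1 : Integrable ψ)
    (hu : u =ᵐ[volume] ψ) :
    (𝓕 u : Lp ℂ 2 (volume : Measure ℝ)) =ᵐ[volume] fun ξ => expTransform ψ (-2 * Real.pi * ξ) := by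
  have hc : Continuous fun ξ : ℝ => expTransform ψ (-2 * Real.pi * ξ) :=
    (continuous_expTransform h1).comp (by fun_prop)
  refine ae_eq_of_forall_integral_mul_schwartz
    (locallyIntegrable_of_memLp_two (Lp.memLp _)) hc.locallyIntegrable fun φ => ?_
  have e2 := VectorFourier.integral_fourierIntegral_smul_eq_flip (μ := (volume : Measure ℝ))
    (ν := (volume : Measure ℝ)) (L := innerₗ ℝ) Real.continuous_fourierChar continuous_inner
    h1 (φ.integrable (μ := volume))
  rw [flip_innerₗ] at e2
  have e3 : ∀ ξ, VectorFourier.fourierIntegral Real.fourierChar volume (innerₗ ℝ) ψ ξ =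
      expTransform ψ (-2 * Real.pi * ξ) := fun ξ => fourier_eq_expTransform ψ ξ
  have e4 : ∀ ξ, VectorFourier.fourierIntegral Real.fourierChar volume (innerₗ ℝ) (⇑φ) ξ =
      (𝓕 φ : 𝓢(ℝ, ℂ)) ξ := fun ξ => rfl
  simp only [e3, e4, smul_eq_mul] at e2
  rw [integral_mul_fourier_Lp, e2]
  refine integral_congr_ae ?_
  filter_upwards [hu] with x hx
  rw [hx]

/-- `f` and `F` are square integrable and `f(t) = ∫ F(τ) e^{itτ} dτ` in the sense of tempered
distributions. -/
structure IsTimeTransform (f F : ℝ → ℂ) : Prop where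
  memLp_left : MemLp f 2
  memLp_right : MemLp F 2
  integral_mul : ∀ φ : 𝓢(ℝ, ℂ), ∫ t, f t * φ t = ∫ τ, F τ * timeTransform φ τ

lemma memLp_comp_mul_left {F : ℝ → ℂ} (hF : MemLp F 2) {c : ℝ} (hc : c ≠ 0) :
    MemLp (fun x => F (c * x)) 2 := by
  have h1 : MemLp F 2 (Measure.map (c * ·) volume) := by
    rw [Real.map_volume_mul_left hc]
    exact hF.smul_measure ENNReal.ofReal_ne_top
  exact (memLp_map_measure_iff h1.1 (by fun_prop)).1 h1

lemma integral_comp_dilation (g : ℝ → ℂ) :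
    ∫ ξ, ((2 * Real.pi : ℝ) : ℂ) * g (-2 * Real.pi * ξ) = ∫ τ, g τ := by
  have hpi := Real.pi_pos
  rw [integral_const_mul, Measure.integral_comp_mul_left, abs_inv, abs_mul, abs_neg, abs_two,
    abs_of_pos hpi, Complex.real_smul, ← mul_assoc, ← Complex.ofReal_mul,
    mul_inv_cancel₀ (by positivity)]
  simp

/-- The unnormalized transform in `L²`, expressed through the unitary one of Mathlib, whose kernel is
`e^{-2πixξ}`. -/
lemma exists_fourier_Lp {F : ℝ → ℂ} (hF : MemLp F 2) :
    ∃ γ : Lp ℂ 2 (volume : Measure ℝ), IsTimeTransform (𝓕 γ : Lp ℂ 2 (volume : Measure ℝ)) F ∧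
      (γ : ℝ → ℂ) =ᵐ[volume] fun ξ => (2 * Real.pi : ℝ) * F (-2 * Real.pi * ξ) := by
  have hpi := Real.pi_pos
  have hm : MemLp (fun ξ => ((2 * Real.pi : ℝ) : ℂ) * F (-2 * Real.pi * ξ)) 2 :=
    (memLp_comp_mul_left hF (by simp [hpi.ne'])).const_mul _
  obtain ⟨u, hu⟩ : ∃ u : Lp ℂ 2 (volume : Measure ℝ), (u : ℝ → ℂ) =ᵐ[volume]
      fun ξ => ((2 * Real.pi : ℝ) : ℂ) * F (-2 * Real.pi * ξ) := ⟨hm.toLp _, hm.coeFn_toLp⟩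
  refine ⟨u, ⟨Lp.memLp _, hF, fun φ => ?_⟩, hu⟩
  rw [integral_mul_fourier_Lp, ← integral_comp_dilation (fun τ => F τ * timeTransform φ τ)]
  refine integral_congr_ae ?_
  filter_upwards [hu] with ξ hξ
  rw [hξ, fourier_eq_timeTransform]; ring

lemma exists_isTimeTransform {F : ℝ → ℂ} (hF : MemLp F 2) : ∃ f, IsTimeTransform f F := by
  obtain ⟨γ, hγ, -⟩ := exists_fourier_Lp hF
  exact ⟨_, hγ⟩

lemma IsTimeTransform.ae_eq {f g F : ℝ → ℂ} (hf : IsTimeTransform f F)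
    (hg : LocallyIntegrable g)
    (h : ∀ φ : 𝓢(ℝ, ℂ), ∫ t, g t * φ t = ∫ τ, F τ * timeTransform φ τ) : f =ᵐ[volume] g :=
  ae_eq_of_forall_integral_mul_schwartz (locallyIntegrable_of_memLp_two hf.memLp_left) hg
    fun φ => (hf.integral_mul φ).trans (h φ).symm

/-- The pairing formula extends from Schwartz functions to `L¹ ∩ L²`. -/
lemma IsTimeTransform.integral_mul_of_memLp {f F ψ : ℝ → ℂ} (hf : IsTimeTransform f F)
    (h1 : Integrable ψ) (h2 : MemLp ψ 2) :
    ∫ t, f t * ψ t = ∫ τ, F τ * expTransform ψ τ := by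
  obtain ⟨γ, hγ, hγF⟩ := exists_fourier_Lp hf.memLp_right
  have hae := hγ.ae_eq (locallyIntegrable_of_memLp_two hf.memLp_left) hf.integral_mul
  obtain ⟨u, hu⟩ : ∃ u : Lp ℂ 2 (volume : Measure ℝ), (u : ℝ → ℂ) =ᵐ[volume] ψ :=
    ⟨h2.toLp _, h2.coeFn_toLp⟩
  calc ∫ t, f t * ψ t = ∫ x, (𝓕 γ : Lp ℂ 2 (volume : Measure ℝ)) x * u x := by
        refine integral_congr_ae ?_
        filter_upwards [hae, hu] with x e1 e2
        rw [e1, e2]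
    _ = ∫ x, γ x * (𝓕 u : Lp ℂ 2 (volume : Measure ℝ)) x := integral_fourier_mul_Lp γ u
    _ = ∫ ξ, ((2 * Real.pi : ℝ) : ℂ) * (F (-2 * Real.pi * ξ) *
          expTransform ψ (-2 * Real.pi * ξ)) := by
        refine integral_congr_ae ?_
        filter_upwards [hγF, fourier_Lp_ae_eq h1 hu] with x e1 e2
        rw [e1, e2]; ring
    _ = ∫ τ, F τ * expTransform ψ τ :=
        integral_comp_dilation (fun τ => F τ * expTransform ψ τ)

lemma hasTemperateGrowth_exp (x : ℝ) :
    (fun t : ℝ => Complex.exp (Complex.I * t * x)).HasTemperateGrowth := by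
  refine ⟨((contDiff_const.mul Complex.ofRealCLM.contDiff).mul contDiff_const).cexp,
    fun n => ⟨0, |x| ^ n, fun t => ?_⟩⟩
  have h1 : ∀ n : ℕ, iteratedDeriv n (fun t : ℝ => Complex.exp (Complex.I * t * x)) =
      fun t : ℝ => (Complex.I * x) ^ n * Complex.exp (Complex.I * t * x) := by
    intro n
    induction n with
    | zero => simp
    | succ n ih =>
      rw [iteratedDeriv_succ, ih]
      funext t
      have h2 : HasDerivAt (fun t : ℝ => Complex.I * (t : ℂ) * x) (Complex.I * x) t := by
        have := (Complex.ofRealCLM.hasDerivAt (x := t)).const_mul Complex.I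
        simpa using this.mul_const (x : ℂ)
      rw [((h2.cexp).const_mul ((Complex.I * (x : ℂ)) ^ n)).deriv]
      ring
  rw [norm_iteratedFDeriv_eq_norm_iteratedDeriv, h1, norm_mul, norm_exp_I_mul_mul]
  simp

/-- The modulation `t ↦ e^{itx} φ(t)` of a Schwartz function. -/
def expMul (x : ℝ) (φ : 𝓢(ℝ, ℂ)) : 𝓢(ℝ, ℂ) :=
  SchwartzMap.smulLeftCLM ℂ (fun t : ℝ => Complex.exp (Complex.I * t * x)) φ

lemma expMul_apply (x t : ℝ) (φ : 𝓢(ℝ, ℂ)) :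
    expMul x φ t = Complex.exp (Complex.I * t * x) * φ t := by
  simp [expMul, SchwartzMap.smulLeftCLM_apply_apply (hasTemperateGrowth_exp x)]

lemma timeTransform_expMul (x y : ℝ) (φ : 𝓢(ℝ, ℂ)) :
    timeTransform (expMul x φ) y = timeTransform φ (x + y) := by
  rw [timeTransform_apply, timeTransform_apply]
  unfold expTransform
  refine integral_congr_ae (Filter.Eventually.of_forall fun t => ?_)
  simp only [expMul_apply]
  rw [← mul_assoc, ← Complex.exp_add]
  congr 2
  push_cast; ring

/-! ### Products in time and convolutions in frequency -/

/-- The convolution `∫ F(τ - y) G(y) dy` of complex-valued functions on the line. -/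
def conv (F G : ℝ → ℂ) (τ : ℝ) : ℂ := ∫ y, F (τ - y) * G y

/-- The convolution of the absolute values. -/
def absConv (F G : ℝ → ℂ) (τ : ℝ) : ℝ≥0∞ := ∫⁻ y, ‖F (τ - y)‖ₑ * ‖G y‖ₑ

lemma enorm_conv_le (F G : ℝ → ℂ) (τ : ℝ) : ‖conv F G τ‖ₑ ≤ absConv F G τ := by
  refine (enorm_integral_le_lintegral_enorm _).trans (le_of_eq ?_)
  simp only [enorm_mul, absConv]

lemma measurable_conv {F G : ℝ → ℂ} (hF : Measurable F) (hG : Measurable G) :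
    Measurable (conv F G) := by
  have h : Measurable fun w : ℝ × ℝ => F (w.1 - w.2) * G w.2 := by fun_prop
  exact (h.stronglyMeasurable.integral_prod_right).measurable

lemma absConv_sq_le {F G : ℝ → ℂ} (hF : Measurable F) (hG : Measurable G) (τ : ℝ) :
    absConv F G τ ^ 2 ≤ (∫⁻ y, ‖F y‖ₑ ^ 2) * ∫⁻ y, ‖G y‖ₑ ^ 2 := by
  refine (sq_lintegral_mul_le _ (by fun_prop) (by fun_prop)).trans (le_of_eq ?_)
  rw [lintegral_sub_left_eq_self (fun y => ‖F y‖ₑ ^ 2)]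

lemma lintegral_enorm_sq_lt_top {F : ℝ → ℂ} (hF : MemLp F 2) : ∫⁻ y, ‖F y‖ₑ ^ 2 < ⊤ := by
  have h := lintegral_rpow_enorm_lt_top_of_eLpNorm_lt_top (by norm_num) (by norm_num) hF.2
  norm_num at h
  exact h

lemma memLp_two_of_lintegral {F : ℝ → ℂ} (hF : Measurable F) (h : ∫⁻ y, ‖F y‖ₑ ^ 2 < ⊤) :
    MemLp F 2 := by
  refine ⟨hF.aestronglyMeasurable, ?_⟩
  rw [eLpNorm_lt_top_iff_lintegral_rpow_enorm_lt_top (by norm_num) (by norm_num)]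
  norm_num
  exact h

/-- The convolution of two functions whose products with `⟨τ - a⟩^{1/2}` and `⟨τ - b⟩^{1/2}` are
square integrable is square integrable: by Cauchy–Schwarz, since `⟨τ - y - a⟩⁻¹ ⟨y - b⟩⁻¹` has
bounded integral in `y`. -/
lemma memLp_conv {F G : ℝ → ℂ} (hF : Measurable F) (hG : Measurable G) {a b : ℝ}
    (hFw : ∫⁻ y, (decay (-(1 / 2)) (y - a) * ‖F y‖ₑ) ^ 2 < ⊤)
    (hGw : ∫⁻ y, (decay (-(1 / 2)) (y - b) * ‖G y‖ₑ) ^ 2 < ⊤) : MemLp (conv F G) 2 := by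
  obtain ⟨C, hC⟩ := exists_lintegral_decay_mul_decay_le (a := 1) (b := 1) (c := 0) le_rfl
    zero_le_one zero_le_one (by norm_num)
  refine memLp_two_of_lintegral (measurable_conv hF hG) ?_
  let F' : ℝ → ℝ≥0∞ := fun y => decay (-(1 / 2)) (y - a) * ‖F y‖ₑ
  let G' : ℝ → ℝ≥0∞ := fun y => decay (-(1 / 2)) (y - b) * ‖G y‖ₑ
  have hF' : Measurable F' := by fun_prop
  have hG' : Measurable G' := by fun_prop
  have hone : ∀ x, decay (-(1 / 2)) x * decay (1 / 2) x = 1 := fun x => by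
    rw [decay_mul]; simp [decay_zero]
  have hpt : ∀ τ, ‖conv F G τ‖ₑ ^ 2 ≤ C * ∫⁻ y, F' (τ - y) ^ 2 * G' y ^ 2 := by
    intro τ
    have e1 : absConv F G τ = ∫⁻ y, (F' (τ - y) * G' y) *
        (decay (1 / 2) (τ - y - a) * decay (1 / 2) (y - b)) := by
      refine lintegral_congr fun y => ?_
      calc ‖F (τ - y)‖ₑ * ‖G y‖ₑ
          = (decay (-(1 / 2)) (τ - y - a) * decay (1 / 2) (τ - y - a)) * ‖F (τ - y)‖ₑ *
            ((decay (-(1 / 2)) (y - b) * decay (1 / 2) (y - b)) * ‖G y‖ₑ) := by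
            rw [hone, hone, one_mul, one_mul]
        _ = _ := by simp only [F', G']; ring
    calc ‖conv F G τ‖ₑ ^ 2 ≤ absConv F G τ ^ 2 := by gcongr; exact enorm_conv_le F G τ
      _ ≤ (∫⁻ y, (F' (τ - y) * G' y) ^ 2) *
          ∫⁻ y, (decay (1 / 2) (τ - y - a) * decay (1 / 2) (y - b)) ^ 2 := by
          rw [e1]; exact sq_lintegral_mul_le _ (by fun_prop) (by fun_prop)
      _ ≤ (∫⁻ y, (F' (τ - y) * G' y) ^ 2) * C := by
          gcongr
          calc ∫⁻ y, (decay (1 / 2) (τ - y - a) * decay (1 / 2) (y - b)) ^ 2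
              = ∫⁻ y, decay 1 (y - (τ - a)) * decay 1 (y - b) := by
                refine lintegral_congr fun y => ?_
                rw [mul_pow, sq_decay, sq_decay, ← decay_neg 1 (τ - y - a)]
                congr 2; ring
            _ ≤ C * decay 0 (τ - a - b) := hC _ _
            _ = C := by rw [decay_zero, mul_one]
      _ = _ := by simp only [mul_pow]; rw [mul_comm]
  calc ∫⁻ τ, ‖conv F G τ‖ₑ ^ 2 ≤ ∫⁻ τ, C * ∫⁻ y, F' (τ - y) ^ 2 * G' y ^ 2 := lintegral_mono hpt
    _ = C * ∫⁻ τ, ∫⁻ y, F' (τ - y) ^ 2 * G' y ^ 2 := lintegral_const_mul' _ _ (by finiteness)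
    _ = C * ∫⁻ y, (∫⁻ x, F' x ^ 2) * G' y ^ 2 := by
        rw [lintegral_lintegral_swap (by fun_prop)]
        congr 1
        refine lintegral_congr fun y => ?_
        rw [lintegral_mul_const _ (by fun_prop),
          lintegral_sub_right_eq_self (fun x => F' x ^ 2) y]
    _ = C * ((∫⁻ x, F' x ^ 2) * ∫⁻ y, G' y ^ 2) := by rw [lintegral_const_mul _ (by fun_prop)]
    _ < ⊤ := ENNReal.mul_lt_top ENNReal.coe_lt_top (ENNReal.mul_lt_top hFw hGw)

lemma integrable_conv_kernel {F G χ : ℝ → ℂ} (hF : Measurable F) (hG : Measurable G)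
    (hF2 : MemLp F 2) (hG2 : MemLp G 2) (hχ : Measurable χ) (hχ1 : Integrable χ) :
    Integrable (fun w : ℝ × ℝ => F (w.1 - w.2) * G w.2 * χ w.1) (volume.prod volume) := by
  have hm : Measurable fun w : ℝ × ℝ => F (w.1 - w.2) * G w.2 * χ w.1 := by fun_prop
  refine ⟨hm.aestronglyMeasurable, ?_⟩
  unfold HasFiniteIntegral
  rw [lintegral_prod _ (by fun_prop)]
  set A := (∫⁻ y, ‖F y‖ₑ ^ 2) * ∫⁻ y, ‖G y‖ₑ ^ 2
  have hA : A < ⊤ := ENNReal.mul_lt_top (lintegral_enorm_sq_lt_top hF2)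
    (lintegral_enorm_sq_lt_top hG2)
  calc ∫⁻ τ, ∫⁻ y, ‖F (τ - y) * G y * χ τ‖ₑ ≤ ∫⁻ τ, (A ^ (1 / 2 : ℝ)) * ‖χ τ‖ₑ := by
        refine lintegral_mono fun τ => ?_
        simp only [enorm_mul]
        rw [lintegral_mul_const _ (by fun_prop)]
        gcongr
        rw [← ENNReal.pow_le_pow_left_iff two_ne_zero, ← ENNReal.rpow_natCast (A ^ (1 / 2 : ℝ)),
          ← ENNReal.rpow_mul]
        norm_num
        exact absConv_sq_le hF hG τ
    _ = A ^ (1 / 2 : ℝ) * ∫⁻ τ, ‖χ τ‖ₑ := lintegral_const_mul _ (by fun_prop)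
    _ < ⊤ := ENNReal.mul_lt_top (by finiteness) hχ1.2

/-- Products of square integrable functions correspond to convolutions. The pairing formula for `f`
is applied to `g φ`, whose transform is found from the formula for `g` and the modulated test
functions. -/
lemma IsTimeTransform.integral_mul_mul {f g F G : ℝ → ℂ} (hf : IsTimeTransform f F)
    (hg : IsTimeTransform g G) (hF : Measurable F) (hG : Measurable G) (φ : 𝓢(ℝ, ℂ)) :
    ∫ t, f t * g t * φ t = ∫ τ, conv F G τ * timeTransform φ τ := by
  have hφ2 : MemLp (φ : ℝ → ℂ) 2 := φ.memLp 2 volume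
  have hφt : MemLp (φ : ℝ → ℂ) ⊤ := φ.memLp_top volume
  have h1 : Integrable (fun t => g t * φ t) := hg.memLp_left.integrable_mul hφ2
  have h2 : MemLp (fun t => g t * φ t) 2 := hφt.mul' hg.memLp_left
  set χ := timeTransform φ
  have hχ : Measurable χ := χ.continuous.measurable
  have hχ1 : Integrable χ := χ.integrable
  have hK := integrable_conv_kernel hF hG hf.memLp_right hg.memLp_right hχ hχ1
  have hexp : ∀ x, expTransform (fun t => g t * φ t) x = ∫ y, G y * χ (x + y) := by
    intro x
    have := hg.integral_mul (expMul x φ)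
    simp only [timeTransform_expMul, expMul_apply] at this
    rw [← this]
    refine integral_congr_ae (Filter.Eventually.of_forall fun t => ?_)
    simp only
    ring
  have hshear : MeasurePreserving (fun w : ℝ × ℝ => (w.1 + w.2, w.2)) (volume.prod volume)
      (volume.prod volume) := by
    have e1 := (MeasurePreserving.id (volume : Measure ℝ)).skew_product
      (μc := (volume : Measure ℝ)) (μd := (volume : Measure ℝ))
      (g := fun y x => x + y) (by fun_prop)
      (Filter.Eventually.of_forall fun y => map_add_right_eq_self volume y)
    have e2 := (Measure.measurePreserving_swap (μ := (volume : Measure ℝ))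
      (ν := (volume : Measure ℝ))).comp (e1.comp Measure.measurePreserving_swap)
    exact e2
  have hK' : Integrable (fun w : ℝ × ℝ => F w.1 * G w.2 * χ (w.1 + w.2))
      (volume.prod volume) := by
    have := hshear.integrable_comp_of_integrable hK
    refine this.congr (Filter.Eventually.of_forall fun w => ?_)
    simp
  calc ∫ t, f t * g t * φ t = ∫ t, f t * (g t * φ t) := by simp only [mul_assoc]
    _ = ∫ x, F x * ∫ y, G y * χ (x + y) := by
        rw [hf.integral_mul_of_memLp h1 h2]; simp only [hexp]
    _ = ∫ x, ∫ y, F x * G y * χ (x + y) := by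
        simp only [← integral_const_mul, mul_assoc]
    _ = ∫ y, ∫ x, F x * G y * χ (x + y) := integral_integral_swap hK'
    _ = ∫ y, ∫ τ, F (τ - y) * G y * χ τ := by
        refine integral_congr_ae (Filter.Eventually.of_forall fun y => ?_)
        simp only
        rw [← integral_sub_right_eq_self _ y]
        simp
    _ = ∫ τ, ∫ y, F (τ - y) * G y * χ τ := (integral_integral_swap hK).symm
    _ = _ := by simp only [integral_mul_const]; rfl

lemma IsTimeTransform.mul {f g F G : ℝ → ℂ} (hf : IsTimeTransform f F)
    (hg : IsTimeTransform g G) (hF : Measurable F) (hG : Measurable G)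
    (hFG : MemLp (conv F G) 2) : IsTimeTransform (fun t => f t * g t) (conv F G) := by
  obtain ⟨h, hh⟩ := exists_isTimeTransform hFG
  have hfg : Integrable (fun t => f t * g t) := hf.memLp_left.integrable_mul hg.memLp_left
  have hae := hh.ae_eq hfg.locallyIntegrable (fun φ => hf.integral_mul_mul hg hF hG φ)
  exact ⟨hh.memLp_left.ae_eq hae, hFG, fun φ => hf.integral_mul_mul hg hF hG φ⟩

/-- A locally integrable function on `(-δ, δ)` is determined there by its pairings with test
functions. -/
lemma IsTimeTransform.ae_eq_on {δ : ℝ} {u f F : ℝ → ℂ} (hf : IsTimeTransform f F)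
    (hu : LocallyIntegrableOn u (Ioo (-δ) δ))
    (h : ∀ φ : 𝓢(ℝ, ℂ), IsTest δ φ → ∫ t, u t * φ t = ∫ τ, F τ * timeTransform φ τ) :
    ∀ᵐ t, t ∈ Ioo (-δ) δ → u t = f t := by
  have hfl : LocallyIntegrableOn f (Ioo (-δ) δ) :=
    (locallyIntegrable_of_memLp_two hf.memLp_left).locallyIntegrableOn _
  have key := isOpen_Ioo.ae_eq_zero_of_integral_contDiff_smul_eq_zero (μ := volume)
    (f := fun t => u t - f t) (hu.sub hfl) (fun θ hθ hc hs => ?_)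
  · filter_upwards [key] with t ht hmem
    exact sub_eq_zero.1 (ht hmem)
  have hc' : HasCompactSupport (Complex.ofRealCLM ∘ θ) := hc.comp_left rfl
  have hθ' : ContDiff ℝ ∞ (Complex.ofRealCLM ∘ θ) := by fun_prop
  have hts : tsupport (Complex.ofRealCLM ∘ θ) ⊆ tsupport θ :=
    closure_mono (Function.support_comp_subset (by simp) θ)
  set φ : 𝓢(ℝ, ℂ) := hc'.toSchwartzMap hθ'
  have hφ : ∀ t, φ t = (θ t : ℂ) := fun t => rfl
  have e1 : ∫ t, u t * φ t = ∫ t, f t * φ t := by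
    rw [h φ (hts.trans hs), hf.integral_mul]
  have hint : ∀ v : ℝ → ℂ, LocallyIntegrableOn v (Ioo (-δ) δ) →
      Integrable fun t => θ t • v t := by
    intro v hv
    have h1 : IntegrableOn v (tsupport θ) := hv.integrableOn_compact_subset hs hc
    have h2 : IntegrableOn (fun t => θ t • v t) (tsupport θ) :=
      h1.continuousOn_smul hθ.continuous.continuousOn hc
    exact (integrableOn_iff_integrable_of_support_subset
      ((Function.support_smul_subset_left θ v).trans (subset_tsupport θ))).1 h2
  have i1 := hint u hu
  have i2 := hint f hfl
  simp only [smul_sub]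
  rw [integral_sub i1 i2, sub_eq_zero]
  simpa [hφ, mul_comm] using e1

/-- A function of moderate growth in the `L²` sense acts on Schwartz functions through the
transform, and defines a tempered distribution in time. -/
lemma exists_temperedDistribution {K : ℝ → ℂ} (c : ℝ)
    (hK : MemLp (fun τ => ((1 + (τ - c) ^ 2 : ℝ) : ℂ)⁻¹ * K τ) 2) :
    ∃ T : 𝓢'(ℝ, ℂ), ∀ φ : 𝓢(ℝ, ℂ),
      Integrable (fun τ => K τ * timeTransform φ τ) ∧ T φ = ∫ τ, K τ * timeTransform φ τ := by
  let q : ℝ → ℂ := fun τ => ((1 + (τ - c) ^ 2 : ℝ) : ℂ)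
  have hq : q.HasTemperateGrowth := by
    have h1 : (fun τ : ℝ => 1 + (τ - c) ^ 2).HasTemperateGrowth := by fun_prop
    exact Function.HasTemperateGrowth.comp Function.Complex.hasTemperateGrowth_ofReal h1
  have hq0 : ∀ τ, q τ ≠ 0 := fun τ => by
    simp only [q]; exact_mod_cast (by positivity : (1 + (τ - c) ^ 2 : ℝ) ≠ 0)
  obtain ⟨k, hk⟩ : ∃ k : Lp ℂ 2 (volume : Measure ℝ), (k : ℝ → ℂ) =ᵐ[volume]
      fun τ => (q τ)⁻¹ * K τ := ⟨hK.toLp _, hK.coeFn_toLp⟩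
  let S : 𝓢(ℝ, ℂ) →L[ℂ] 𝓢(ℝ, ℂ) := SchwartzMap.smulLeftCLM ℂ q ∘L timeTransform
  have hS : ∀ φ τ, S φ τ = q τ * timeTransform φ τ := fun φ τ => by
    simp [S, SchwartzMap.smulLeftCLM_apply_apply hq]
  let L : 𝓢(ℝ, ℂ) →L[ℂ] ℂ :=
    (ContinuousLinearMap.mul ℂ ℂ).lpPairing (volume : Measure ℝ) 2 2 k ∘L
      SchwartzMap.toLpCLM ℂ ℂ 2 volume ∘L S
  refine ⟨ContinuousLinearMap.toPointwiseConvergenceCLM _ _ _ _ L, fun φ => ?_⟩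
  have hae : (fun τ => K τ * timeTransform φ τ) =ᵐ[volume]
      fun τ => k τ * (S φ).toLp 2 volume τ := by
    filter_upwards [hk, (S φ).coeFn_toLp 2 volume] with τ h1 h2
    rw [h1, h2, hS]
    field_simp [hq0 τ]
  constructor
  · exact ((Lp.memLp k).integrable_mul (Lp.memLp ((S φ).toLp 2 volume))).congr hae.symm
  · have : ContinuousLinearMap.toPointwiseConvergenceCLM _ _ _ _ L φ = L φ := rfl
    rw [this, integral_congr_ae hae]
    simp [L, ContinuousLinearMap.lpPairing_eq_integral]

/-! ### Extensions and their space-time Fourier transforms -/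

/-- The square of the weighted `L²` norm, for nonnegative functions. -/
def sqNorm (s b : ℝ) (f : ℤ × ℝ → ℝ≥0∞) : ℝ≥0∞ := ∫⁻ p, (weight s b p * f p) ^ 2 ∂freqMeasure

lemma weightedL2Norm_eq (s b : ℝ) (F : ℤ × ℝ → ℂ) :
    weightedL2Norm s b F = sqNorm s b (fun p => ‖F p‖ₑ) ^ (1 / 2 : ℝ) := by
  unfold weightedL2Norm sqNorm
  rw [eLpNorm_eq_lintegral_rpow_enorm_toReal (by norm_num) (by norm_num)]
  norm_num
  congr 1
  refine lintegral_congr fun p => ?_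
  have h1 := Real.rpow_nonneg (bracket_pos (p.1 : ℝ)).le s
  have h2 := Real.rpow_nonneg (bracket_pos (p.2 - (p.1 : ℝ) ^ 3)).le b
  rw [← ofReal_norm, ← ofReal_norm,
    Complex.norm_of_nonneg h1, Complex.norm_of_nonneg h2]
  simp only [weight, decay, modulation, neg_neg]

lemma measurable_slice {α : Type*} [MeasurableSpace α] {F : ℤ × ℝ → α} (hF : Measurable F)
    (k : ℤ) : Measurable fun τ => F (k, τ) := hF.comp (by fun_prop)

lemma sqNorm_eq_tsum {s b : ℝ} {f : ℤ × ℝ → ℝ≥0∞} (hf : Measurable f) :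
    sqNorm s b f = ∑' k : ℤ, ∫⁻ τ, (weight s b (k, τ) * f (k, τ)) ^ 2 := by
  unfold sqNorm
  rw [lintegral_prod _ (by fun_prop), lintegral_count]

lemma lintegral_slice_lt_top {s b : ℝ} {f : ℤ × ℝ → ℝ≥0∞} (hf : Measurable f)
    (h : sqNorm s b f < ⊤) (k : ℤ) :
    ∫⁻ τ, (decay (-b) (τ - (k : ℝ) ^ 3) * f (k, τ)) ^ 2 < ⊤ := by
  rw [sqNorm_eq_tsum hf] at h
  have h1 := (ENNReal.le_tsum k).trans_lt h
  have hm := measurable_slice hf k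
  have e : ∀ τ : ℝ, (weight s b (k, τ) * f (k, τ)) ^ 2 =
      decay (-s) (k : ℝ) ^ 2 * (decay (-b) (τ - (k : ℝ) ^ 3) * f (k, τ)) ^ 2 := fun τ => by
    simp only [weight, modulation]; ring
  simp only [e] at h1
  rw [lintegral_const_mul _ (by fun_prop)] at h1
  exact ENNReal.lt_top_of_mul_ne_top_right h1.ne (pow_ne_zero 2 (decay_ne_zero _ _))

/-- `F` is the space-time Fourier transform of an extension of `u` from the time interval, with
spatial Fourier coefficients `U`, of finite `X^{s,1/2}` norm. -/
structure IsExtension (δ s : ℝ) (u U : ℤ → ℝ → ℂ) (F : ℤ × ℝ → ℂ) : Prop where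
  measurable : Measurable F
  finite : sqNorm s (1 / 2) (fun p => ‖F p‖ₑ) < ⊤
  transform : ∀ k, IsTimeTransform (U k) (fun τ => F (k, τ))
  eq_on : ∀ k, ∀ᵐ t, t ∈ Ioo (-δ) δ → u k t = U k t

lemma IsExtension.lintegral_lt_top {δ s : ℝ} {u U : ℤ → ℝ → ℂ} {F : ℤ × ℝ → ℂ}
    (h : IsExtension δ s u U F) (k : ℤ) :
    ∫⁻ τ, (decay (-(1 / 2)) (τ - (k : ℝ) ^ 3) * ‖F (k, τ)‖ₑ) ^ 2 < ⊤ :=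
  lintegral_slice_lt_top h.measurable.enorm h.finite k

lemma memLp_slice {s : ℝ} {F : ℤ × ℝ → ℂ} (hF : Measurable F)
    (h : sqNorm s (1 / 2) (fun p => ‖F p‖ₑ) < ⊤) (k : ℤ) : MemLp (fun τ => F (k, τ)) 2 := by
  refine memLp_two_of_lintegral (measurable_slice hF k)
    (lt_of_le_of_lt (lintegral_mono fun τ => ?_) (lintegral_slice_lt_top hF.enorm h k))
  gcongr
  have : 1 ≤ decay (-(1 / 2)) (τ - (k : ℝ) ^ 3) := by
    rw [← decay_zero (τ - (k : ℝ) ^ 3)]; exact decay_anti (by norm_num) _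
  exact le_mul_of_one_le_left' this

/-- Extensions on the Fourier side come arbitrarily close to the restricted norm. -/
lemma exists_isExtension {δ s : ℝ} {u : ℤ → ℝ → ℂ}
    (hu : ∀ k, LocallyIntegrableOn (u k) (Ioo (-δ) δ)) {a : ℝ≥0∞}
    (ha : restrictedNorm δ s (1 / 2) (pairing u) < a) :
    ∃ U F, IsExtension δ s u U F ∧ weightedL2Norm s (1 / 2) F < a := by
  simp only [restrictedNorm, xNorm, iInf_lt_iff] at ha
  obtain ⟨T, hT, F', ⟨hF'm, hF'⟩, hF'a⟩ := ha
  set F := hF'm.mk F' with hF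
  have hFm : Measurable F := hF'm.stronglyMeasurable_mk.measurable
  have hae : F' =ᵐ[freqMeasure] F := hF'm.ae_eq_mk
  have hk : ∀ k : ℤ, ∀ᵐ τ : ℝ, F' (k, τ) = F (k, τ) := by
    have h1 := Measure.ae_ae_of_ae_prod hae
    intro k
    exact (Measure.ae_count_iff.1 h1) k
  have hFa : weightedL2Norm s (1 / 2) F < a := by
    have : weightedL2Norm s (1 / 2) F = weightedL2Norm s (1 / 2) F' := by
      refine eLpNorm_congr_ae ?_
      filter_upwards [hae] with p hp
      rw [hp]
    rwa [this]
  have hfin : sqNorm s (1 / 2) (fun p => ‖F p‖ₑ) < ⊤ := by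
    have h1 := hFa.trans_le le_top
    rw [weightedL2Norm_eq] at h1
    exact (ENNReal.rpow_lt_top_iff_of_pos (by norm_num)).1 h1
  choose U hU using fun k => exists_isTimeTransform (memLp_slice hFm hfin k)
  refine ⟨U, F, ⟨hFm, hfin, hU, fun k => (hU k).ae_eq_on (hu k) fun φ hφ => ?_⟩, hFa⟩
  have h1 : pairing u k φ = T k φ := (hT k φ hφ).symm
  rw [(hF' k φ).2] at h1
  refine h1.trans (integral_congr_ae ?_)
  filter_upwards [hk k] with τ hτ
  rw [hτ, timeTransform_apply]; rfl

/-- The Fourier transform in time of `u_{k₁} v_{k₂} w_{k₃}`. -/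
def tripleConv (F G H : ℤ × ℝ → ℂ) (q : ℤ × ℤ × ℤ) : ℝ → ℂ :=
  conv (conv (fun τ => F (q.1, τ)) (fun τ => G (q.2.1, τ))) (fun τ => H (q.2.2, τ))

lemma measurable_tripleConv {F G H : ℤ × ℝ → ℂ} (hF : Measurable F) (hG : Measurable G)
    (hH : Measurable H) (q : ℤ × ℤ × ℤ) : Measurable (tripleConv F G H q) :=
  measurable_conv (measurable_conv (measurable_slice hF _) (measurable_slice hG _))
    (measurable_slice hH _)

lemma trilinear_eq_tsum {f g h : ℤ × ℝ → ℝ≥0∞} (hf : Measurable f) (hg : Measurable g)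
    (hh : Measurable h) (k : ℤ) (τ : ℝ) :
    trilinear f g h (k, τ) = ∑' i : ℤ × ℤ, cubicKernel k i.1 i.2 *
      ∫⁻ t, ∫⁻ t', f (k - i.1 - i.2, τ - t - t') * g (i.1, t) * h (i.2, t') := by
  unfold trilinear
  have hm : Measurable fun r : (ℤ × ℝ) × (ℤ × ℝ) => cubicKernel k r.1.1 r.2.1 :=
    (measurable_of_countable fun i : ℤ × ℤ => cubicKernel k i.1 i.2).comp (g := _)
      (f := fun r : (ℤ × ℝ) × (ℤ × ℝ) => (r.1.1, r.2.1)) (by fun_prop)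
  rw [lintegral_freqMeasure_prod (by fun_prop)]
  refine tsum_congr fun i => ?_
  have hc : cubicKernel k i.1 i.2 ≠ ⊤ := by unfold cubicKernel; split_ifs <;> simp
  rw [← lintegral_const_mul' _ _ hc]
  refine lintegral_congr fun t => ?_
  rw [← lintegral_const_mul' _ _ hc]
  rfl

lemma measurable_trilinear_slice {f g h : ℤ × ℝ → ℝ≥0∞} (hf : Measurable f) (hg : Measurable g)
    (hh : Measurable h) (k : ℤ) : Measurable fun τ => trilinear f g h (k, τ) := by
  simp only [trilinear_eq_tsum hf hg hh]
  refine Measurable.tsum fun i => Measurable.const_mul ?_ _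
  have hf' := measurable_slice hf (k - i.1 - i.2)
  have hg' := measurable_slice hg i.1
  have hh' := measurable_slice hh i.2
  have h1 : Measurable fun w : (ℝ × ℝ) × ℝ => f (k - i.1 - i.2, w.1.1 - w.1.2 - w.2) *
      g (i.1, w.1.2) * h (i.2, w.2) := by fun_prop
  exact h1.lintegral_prod_right'.lintegral_prod_right'

/-- The Fourier series of the cubic term converges absolutely where the trilinear expression with
absolute values is finite. -/
lemma tsum_enorm_tripleConv_le {F G H : ℤ × ℝ → ℂ} (hF : Measurable F) (hG : Measurable G)
    (hH : Measurable H) (k : ℤ) (τ : ℝ) :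
    ∑' q : nonresonant k, ‖tripleConv F G H q τ / ((q : ℤ × ℤ × ℤ).1 : ℂ)‖ₑ ≤
      trilinear (fun p => ‖F p‖ₑ) (fun p => ‖G p‖ₑ) (fun p => ‖H p‖ₑ) (k, τ) := by
  rw [trilinear_eq_tsum hF.enorm hG.enorm hH.enorm]
  have hinj : Function.Injective fun q : nonresonant k => ((q : ℤ × ℤ × ℤ).2) := by
    rintro ⟨⟨a, b, c⟩, h, -⟩ ⟨⟨a', b', c'⟩, h', -⟩ (he : (b, c) = (b', c'))
    simp only [Prod.mk.injEq] at he h h'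
    obtain ⟨rfl, rfl⟩ := he
    obtain rfl : a = a' := by omega
    rfl
  refine le_trans (ENNReal.tsum_le_tsum fun q => ?_)
    (ENNReal.tsum_comp_le_tsum_of_injective hinj _)
  obtain ⟨⟨a, b, c⟩, hsum, hres, ha⟩ := q
  simp only at hsum hres ha ⊢
  have hk : k - b - c = a := by omega
  have hker : cubicKernel k b c = ENNReal.ofReal (|(a : ℝ)|⁻¹) := by
    unfold cubicKernel
    rw [hk, if_pos]
    refine ⟨ha, ?_⟩
    rw [show resonance a b c = (b + c) * (a + b) * (a + c) by unfold resonance; ring]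
    exact hres
  have hinv : ‖((a : ℂ))⁻¹‖ₑ = ENNReal.ofReal (|(a : ℝ)|⁻¹) := by
    rw [← ofReal_norm, norm_inv, Complex.norm_intCast]
  rw [hker, hk, div_eq_mul_inv, enorm_mul, hinv, mul_comm]
  gcongr
  have hFa := measurable_slice hF a
  have hGb := measurable_slice hG b
  have hHc := measurable_slice hH c
  calc ‖tripleConv F G H (a, b, c) τ‖ₑ
      ≤ ∫⁻ z, ‖conv (fun τ => F (a, τ)) (fun τ => G (b, τ)) (τ - z)‖ₑ * ‖H (c, z)‖ₑ :=
        enorm_conv_le _ _ _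
    _ ≤ ∫⁻ z, (∫⁻ y, ‖F (a, τ - z - y)‖ₑ * ‖G (b, y)‖ₑ) * ‖H (c, z)‖ₑ := by
        gcongr with z
        exact enorm_conv_le _ _ _
    _ = ∫⁻ z, ∫⁻ y, ‖F (a, τ - z - y)‖ₑ * ‖G (b, y)‖ₑ * ‖H (c, z)‖ₑ := by
        refine lintegral_congr fun z => ?_
        rw [lintegral_mul_const _ (by fun_prop)]
    _ = ∫⁻ t, ∫⁻ t', ‖F (a, τ - t - t')‖ₑ * ‖G (b, t)‖ₑ * ‖H (c, t')‖ₑ := by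
        rw [lintegral_lintegral_swap (by fun_prop)]
        simp only [sub_right_comm]

lemma inv_one_add_sq_le_decay {a : ℝ} (ha : a ≤ 1) (x : ℝ) :
    ‖((1 + x ^ 2 : ℝ) : ℂ)⁻¹‖ₑ ≤ 2 * decay a x := by
  have h2 : (2 : ℝ≥0∞) = ENNReal.ofReal 2 := by simp
  refine le_trans ?_ (mul_le_mul_right (decay_anti ha x) 2)
  unfold decay
  rw [h2, ← ENNReal.ofReal_mul (by norm_num), ← ofReal_norm, norm_inv,
    Complex.norm_of_nonneg (by positivity)]
  refine ENNReal.ofReal_le_ofReal ?_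
  rw [Real.rpow_neg_one, inv_le_comm₀ (by positivity) (by have := bracket_pos x; positivity),
    mul_inv, inv_inv]
  unfold bracket
  have := sq_abs x
  nlinarith [sq_nonneg (|x| - 1), abs_nonneg x]

lemma decay_neg_le {a : ℝ} (ha : a ≤ 1) (x : ℝ) :
    decay (-a) x ≤ 2 * ‖((1 + x ^ 2 : ℝ) : ℂ)‖ₑ := by
  have h2 : (2 : ℝ≥0∞) = ENNReal.ofReal 2 := by simp
  refine (decay_anti (show -1 ≤ -a by linarith) x).trans ?_
  unfold decay
  rw [h2, ← ofReal_norm, ← ENNReal.ofReal_mul (by norm_num),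
    Complex.norm_of_nonneg (by positivity)]
  refine ENNReal.ofReal_le_ofReal ?_
  rw [neg_neg, Real.rpow_one]
  unfold bracket
  have := sq_abs x
  nlinarith [sq_nonneg (|x| - 1), abs_nonneg x]

/-- Schwartz functions are square integrable with the weight `⟨τ - c⟩^a`. -/
lemma lintegral_decay_mul_schwartz_lt_top {a : ℝ} (ha : a ≤ 1) (c : ℝ) (φ : 𝓢(ℝ, ℂ)) :
    ∫⁻ τ, (decay (-a) (τ - c) * ‖φ τ‖ₑ) ^ 2 < ⊤ := by
  let q : ℝ → ℂ := fun τ => ((1 + (τ - c) ^ 2 : ℝ) : ℂ)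
  have hq : q.HasTemperateGrowth := by
    have h1 : (fun τ : ℝ => 1 + (τ - c) ^ 2).HasTemperateGrowth := by fun_prop
    exact Function.HasTemperateGrowth.comp Function.Complex.hasTemperateGrowth_ofReal h1
  set S := SchwartzMap.smulLeftCLM ℂ q φ
  have hS : ∀ τ, S τ = q τ * φ τ := fun τ => by
    simp [S, SchwartzMap.smulLeftCLM_apply_apply hq]
  have h1 := lintegral_enorm_sq_lt_top (S.memLp 2 volume)
  calc ∫⁻ τ, (decay (-a) (τ - c) * ‖φ τ‖ₑ) ^ 2 ≤ ∫⁻ τ, 2 ^ 2 * ‖S τ‖ₑ ^ 2 := by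
        refine lintegral_mono fun τ => ?_
        rw [hS, enorm_mul, ← mul_pow, ← mul_assoc]
        gcongr
        exact decay_neg_le ha _
    _ = 2 ^ 2 * ∫⁻ τ, ‖S τ‖ₑ ^ 2 := lintegral_const_mul' _ _ (by finiteness)
    _ < ⊤ := ENNReal.mul_lt_top (by finiteness) h1

/-! ### The cubic term -/

lemma measurable_of_slice {α : Type*} [MeasurableSpace α] {f : ℤ × ℝ → α}
    (h : ∀ k, Measurable fun τ => f (k, τ)) : Measurable f :=
  measurable_from_prod_countable_right h

/-- The space-time Fourier transform of the cubic term `ℛ(u, v, w)`. -/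
def cubicFourier (F G H : ℤ × ℝ → ℂ) (p : ℤ × ℝ) : ℂ :=
  if p.1 = 0 then 0
  else (Complex.I / 3) * ∑' q : nonresonant p.1, tripleConv F G H q p.2 / ((q : ℤ × ℤ × ℤ).1 : ℂ)

lemma measurable_cubicFourier {F G H : ℤ × ℝ → ℂ} (hF : Measurable F) (hG : Measurable G)
    (hH : Measurable H) : Measurable (cubicFourier F G H) := by
  refine measurable_of_slice fun k => ?_
  by_cases hk : k = 0
  · simp [cubicFourier, hk]
  · simp only [cubicFourier, hk, if_false]
    have h : ∀ q : nonresonant k, Measurable fun τ =>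
        tripleConv F G H q τ / ((q : ℤ × ℤ × ℤ).1 : ℂ) := fun q =>
      (measurable_tripleConv hF hG hH q).div_const _
    exact (Measurable.tsum h).const_mul _

lemma enorm_cubicFourier_le {F G H : ℤ × ℝ → ℂ} (hF : Measurable F) (hG : Measurable G)
    (hH : Measurable H) (p : ℤ × ℝ) :
    ‖cubicFourier F G H p‖ₑ ≤
      trilinear (fun p => ‖F p‖ₑ) (fun p => ‖G p‖ₑ) (fun p => ‖H p‖ₑ) p := by
  unfold cubicFourier
  split_ifs with hk
  · simp
  · rw [enorm_mul]
    have h3 : ‖(Complex.I / 3 : ℂ)‖ₑ ≤ 1 := by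
      rw [← ofReal_norm, ENNReal.ofReal_le_one]
      simp; norm_num
    exact (mul_le_of_le_one_left' h3).trans
      (enorm_tsum_le_tsum_enorm.trans (tsum_enorm_tripleConv_le hF hG hH p.1 p.2))

/-- Functions that are square integrable with a weight `⟨τ - c⟩^b` pair with Schwartz functions. -/
lemma lintegral_mul_schwartz_lt_top {b : ℝ} (hb : -1 ≤ b) {g : ℝ → ℝ≥0∞} (hg : Measurable g) (c : ℝ)
    (h : ∫⁻ τ, (decay (-b) (τ - c) * g τ) ^ 2 < ⊤) (φ : 𝓢(ℝ, ℂ)) :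
    ∫⁻ τ, g τ * ‖φ τ‖ₑ < ⊤ := by
  have hφ : Measurable fun τ => ‖φ τ‖ₑ := φ.continuous.measurable.enorm
  have h1 := lintegral_decay_mul_schwartz_lt_top (a := -b) (by linarith) c φ
  have h2 := sq_lintegral_mul_le volume (f := fun τ => decay (-b) (τ - c) * g τ)
    (g := fun τ => decay (- -b) (τ - c) * ‖φ τ‖ₑ) (by fun_prop) (by fun_prop)
  have e : ∀ τ, decay (-b) (τ - c) * g τ * (decay (- -b) (τ - c) * ‖φ τ‖ₑ) = g τ * ‖φ τ‖ₑ := by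
    intro τ
    have : decay (-b) (τ - c) * decay (- -b) (τ - c) = 1 := by
      rw [decay_mul, add_neg_cancel, decay_zero]
    calc _ = (decay (-b) (τ - c) * decay (- -b) (τ - c)) * (g τ * ‖φ τ‖ₑ) := by ring
      _ = _ := by rw [this, one_mul]
  simp only [e] at h2
  exact (ENNReal.pow_lt_top_iff.1 (h2.trans_lt (ENNReal.mul_lt_top h h1))).resolve_right two_ne_zero

/-- Termwise integration of the Fourier series of the cubic term against a test function. -/
lemma hasSum_integral_tripleConv {F G H : ℤ × ℝ → ℂ} (hF : Measurable F) (hG : Measurable G)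
    (hH : Measurable H) {s b : ℝ} (hb : -1 ≤ b)
    (h : sqNorm s b (trilinear (fun p => ‖F p‖ₑ) (fun p => ‖G p‖ₑ) (fun p => ‖H p‖ₑ)) < ⊤)
    (k : ℤ) (φ : 𝓢(ℝ, ℂ)) :
    HasSum (fun q : nonresonant k =>
        (∫ τ, tripleConv F G H q τ * φ τ) / ((q : ℤ × ℤ × ℤ).1 : ℂ))
      (∫ τ, (∑' q : nonresonant k, tripleConv F G H q τ / ((q : ℤ × ℤ × ℤ).1 : ℂ)) * φ τ) := by
  have hms := measurable_trilinear_slice hF.enorm hG.enorm hH.enorm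
  have hfin := lintegral_mul_schwartz_lt_top hb (hms k) _
    (lintegral_slice_lt_top (measurable_of_slice hms) h k) φ
  have hφ : Measurable (φ : ℝ → ℂ) := φ.continuous.measurable
  have hm : ∀ q : nonresonant k, Measurable fun τ =>
      tripleConv F G H q τ / ((q : ℤ × ℤ × ℤ).1 : ℂ) * φ τ := fun q =>
    ((measurable_tripleConv hF hG hH q).div_const _).mul hφ
  have hsum : ∑' q : nonresonant k, ∫⁻ τ,
      ‖tripleConv F G H q τ / ((q : ℤ × ℤ × ℤ).1 : ℂ) * φ τ‖ₑ ≠ ⊤ := by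
    rw [← lintegral_tsum fun q => (hm q).enorm.aemeasurable]
    refine (lt_of_le_of_lt (lintegral_mono fun τ => ?_) hfin).ne
    simp only [enorm_mul]
    rw [ENNReal.tsum_mul_right]
    gcongr
    exact tsum_enorm_tripleConv_le hF hG hH k τ
  have e1 : ∀ q : nonresonant k, (∫ τ, tripleConv F G H q τ * φ τ) / ((q : ℤ × ℤ × ℤ).1 : ℂ) =
      ∫ τ, tripleConv F G H q τ / ((q : ℤ × ℤ × ℤ).1 : ℂ) * φ τ := fun q => by
    rw [← integral_div]
    exact integral_congr_ae (.of_forall fun τ => by ring)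
  simp only [e1, ← tsum_mul_right]
  rw [integral_tsum (fun q => (hm q).aestronglyMeasurable) hsum]
  refine (Summable.of_norm_bounded (ENNReal.summable_toReal hsum) fun q => ?_).hasSum
  exact (norm_integral_le_lintegral_norm _).trans (le_of_eq (by simp only [ofReal_norm]))

section Extension

variable {δ s : ℝ} {u v w U V W : ℤ → ℝ → ℂ} {F G H : ℤ × ℝ → ℂ}

lemma IsExtension.isTimeTransform_mul (hu : IsExtension δ s u U F) (hv : IsExtension δ s v V G)
    (k₁ k₂ : ℤ) : IsTimeTransform (fun t => U k₁ t * V k₂ t)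
      (conv (fun τ => F (k₁, τ)) (fun τ => G (k₂, τ))) :=
  have hF := measurable_slice hu.measurable k₁
  have hG := measurable_slice hv.measurable k₂
  (hu.transform k₁).mul (hv.transform k₂) hF hG
    (memLp_conv hF hG (hu.lintegral_lt_top k₁) (hv.lintegral_lt_top k₂))

lemma IsExtension.integrableOn_mul_mul (hu : IsExtension δ s u U F) (hv : IsExtension δ s v V G)
    (hw : IsExtension δ s w W H) (k₁ k₂ k₃ : ℤ) :
    IntegrableOn (fun t => u k₁ t * v k₂ t * w k₃ t) (Ioo (-δ) δ) := by
  have h1 : Integrable fun t => U k₁ t * V k₂ t * W k₃ t :=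
    (hu.isTimeTransform_mul hv k₁ k₂).memLp_left.integrable_mul (hw.transform k₃).memLp_left
  refine h1.integrableOn.congr ?_
  rw [Filter.EventuallyEq, ae_restrict_iff' measurableSet_Ioo]
  filter_upwards [hu.eq_on k₁, hv.eq_on k₂, hw.eq_on k₃] with t h1 h2 h3 ht
  rw [h1 ht, h2 ht, h3 ht]

lemma IsExtension.cubicTerm_eq (hu : IsExtension δ s u U F) (hv : IsExtension δ s v V G)
    (hw : IsExtension δ s w W H) {φ : 𝓢(ℝ, ℂ)} (hφ : IsTest δ φ) (q : ℤ × ℤ × ℤ) :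
    cubicTerm u v w φ q =
      (∫ τ, tripleConv F G H q τ * timeTransform φ τ) / (q.1 : ℂ) := by
  have hm := measurable_conv (measurable_slice hu.measurable q.1)
    (measurable_slice hv.measurable q.2.1)
  unfold cubicTerm tripleConv
  rw [← (hu.isTimeTransform_mul hv q.1 q.2.1).integral_mul_mul (hw.transform q.2.2) hm
    (measurable_slice hw.measurable _)]
  congr 1
  refine integral_congr_ae ?_
  filter_upwards [hu.eq_on q.1, hv.eq_on q.2.1, hw.eq_on q.2.2] with t h1 h2 h3
  by_cases ht : t ∈ Ioo (-δ) δ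
  · rw [h1 ht, h2 ht, h3 ht]
  · have : φ t = 0 := image_eq_zero_of_notMem_tsupport fun h => ht (hφ h)
    simp [this]

/-- Extensions of `u`, `v`, `w` give a distribution that agrees with `ℛ(u, v, w)` on the time
interval, so its norm bounds the restricted norm. -/
lemma IsExtension.restrictedNorm_cubicR_le (hu : IsExtension δ s u U F)
    (hv : IsExtension δ s v V G) (hw : IsExtension δ s w W H) {s₁ b : ℝ} (hb : -1 ≤ b)
    (h : sqNorm s₁ b (trilinear (fun p => ‖F p‖ₑ) (fun p => ‖G p‖ₑ) (fun p => ‖H p‖ₑ)) < ⊤) :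
    (∀ k : ℤ, ∀ φ : 𝓢(ℝ, ℂ), IsTest δ φ →
      Summable fun q : nonresonant k => cubicTerm u v w φ q) ∧
    restrictedNorm δ s₁ b (cubicR u v w) ≤ weightedL2Norm s₁ b (cubicFourier F G H) := by
  have hF := hu.measurable
  have hG := hv.measurable
  have hH := hw.measurable
  refine ⟨fun k φ hφ => ?_, ?_⟩
  · simp only [hu.cubicTerm_eq hv hw hφ]
    exact (hasSum_integral_tripleConv hF hG hH hb h k _).summable
  have hm := measurable_cubicFourier hF hG hH
  have hfin : sqNorm s₁ b (fun p => ‖cubicFourier F G H p‖ₑ) < ⊤ := by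
    refine lt_of_le_of_lt (lintegral_mono fun p => ?_) h
    gcongr
    exact enorm_cubicFourier_le hF hG hH p
  have hK : ∀ k : ℤ, MemLp (fun τ : ℝ => ((1 + (τ - (k : ℝ) ^ 3) ^ 2 : ℝ) : ℂ)⁻¹ *
      cubicFourier F G H (k, τ)) 2 := by
    intro k
    have hmk := measurable_slice hm k
    refine memLp_two_of_lintegral (by fun_prop) ?_
    calc ∫⁻ τ : ℝ, ‖((1 + (τ - (k : ℝ) ^ 3) ^ 2 : ℝ) : ℂ)⁻¹ * cubicFourier F G H (k, τ)‖ₑ ^ 2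
        ≤ ∫⁻ τ, 2 ^ 2 * (decay (-b) (τ - (k : ℝ) ^ 3) * ‖cubicFourier F G H (k, τ)‖ₑ) ^ 2 := by
          refine lintegral_mono fun τ => ?_
          rw [enorm_mul, ← mul_pow, ← mul_assoc]
          gcongr
          exact inv_one_add_sq_le_decay (by linarith) _
      _ = 2 ^ 2 * ∫⁻ τ, (decay (-b) (τ - (k : ℝ) ^ 3) * ‖cubicFourier F G H (k, τ)‖ₑ) ^ 2 :=
          lintegral_const_mul' _ _ (by finiteness)
      _ < ⊤ := ENNReal.mul_lt_top (by finiteness) (lintegral_slice_lt_top hm.enorm hfin k)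
  choose T hT using fun k => exists_temperedDistribution _ (hK k)
  have hTF : HasSpaceTimeFourier T (cubicFourier F G H) := by
    refine ⟨hm.aestronglyMeasurable, fun k φ => ?_⟩
    have := hT k φ
    simp only [timeTransform_apply] at this
    exact this
  refine (iInf₂_le T fun k φ hφ => ?_).trans (iInf₂_le _ hTF)
  rw [(hT k φ).2]
  by_cases hk : k = 0
  · simp [cubicFourier, cubicR, hk]
  · simp only [cubicFourier, cubicR, hk, if_false, hu.cubicTerm_eq hv hw hφ, mul_assoc]
    rw [integral_const_mul, (hasSum_integral_tripleConv hF hG hH hb h k _).tsum_eq]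

end Extension

/-- An upper bound by a product that holds for all larger factors holds in the limit. -/
lemma le_mul_mul_of_forall_lt {X C A B D : ℝ≥0∞} (hC : C ≠ ⊤) (hA : A ≠ ⊤) (hB : B ≠ ⊤)
    (hD : D ≠ ⊤)
    (h : ∀ a b d, A < a → B < b → D < d → X ≤ C * a * b * d) :
    X ≤ C * A * B * D := by
  have ht : ∀ {Y : ℝ≥0∞}, Filter.Tendsto (fun η : ℝ≥0∞ => Y + η) (nhdsWithin 0 (Ioi 0))
      (nhds Y) := fun {Y} => by
    have : Filter.Tendsto (fun η : ℝ≥0∞ => Y + η) (nhds 0) (nhds (Y + 0)) :=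
      (continuous_const.add continuous_id).tendsto 0
    rw [add_zero] at this
    exact this.mono_left nhdsWithin_le_nhds
  have h1 := ENNReal.Tendsto.const_mul (a := C) (ht (Y := A)) (.inr hC)
  have h2 := ENNReal.Tendsto.mul h1 (.inr hB) (ht (Y := B)) (.inr (by finiteness))
  have h3 := ENNReal.Tendsto.mul h2 (.inr hD) (ht (Y := D)) (.inr (by finiteness))
  refine ge_of_tendsto h3 ?_
  filter_upwards [self_mem_nhdsWithin] with η (h0 : 0 < η)
  exact h _ _ _ (ENNReal.lt_add_right hA h0.ne') (ENNReal.lt_add_right hB h0.ne')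
    (ENNReal.lt_add_right hD h0.ne')

end PeriodicKdV

end

theorem proposition3p4 (s s₁ : ℝ) (hs : -(1 / 2 : ℝ) < s) (hs₁ : s₁ < min (s + 1) (3 * s + 1)) :
    ∃ ε₀ : ℝ, 0 < ε₀ ∧ ∀ ε : ℝ, 0 < ε → ε < ε₀ →
      ∃ C : ℝ≥0, ∀ δ : ℝ, 0 < δ → ∀ u v w : ℤ → ℝ → ℂ,
        PeriodicKdV.MemRestricted δ s (1 / 2) u →
        PeriodicKdV.MemRestricted δ s (1 / 2) v →
        PeriodicKdV.MemRestricted δ s (1 / 2) w →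
        -- the sum defining `ℛ(u, v, w)` converges in the sense of distributions
        ((∀ k₁ k₂ k₃ : ℤ,
            IntegrableOn (fun t : ℝ => u k₁ t * v k₂ t * w k₃ t) (Ioo (-δ) δ)) ∧
          (∀ k : ℤ, k ≠ 0 → ∀ φ : 𝓢(ℝ, ℂ), PeriodicKdV.IsTest δ φ →
            Summable (fun q : PeriodicKdV.nonresonant k =>
              PeriodicKdV.cubicTerm u v w φ q))) ∧
        PeriodicKdV.restrictedNorm δ s₁ (-(1 / 2) + ε) (PeriodicKdV.cubicR u v w) ≤
          C * PeriodicKdV.restrictedNorm δ s (1 / 2) (PeriodicKdV.pairing u) *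
            PeriodicKdV.restrictedNorm δ s (1 / 2) (PeriodicKdV.pairing v) *
            PeriodicKdV.restrictedNorm δ s (1 / 2) (PeriodicKdV.pairing w) := by
  open PeriodicKdV in
  obtain ⟨ε₀, hε₀, hmain⟩ := exists_lintegral_sq_trilinear_le hs hs₁
  refine ⟨ε₀, hε₀, fun ε hε hε' => ?_⟩
  obtain ⟨C, hC⟩ := hmain ε hε hε'
  refine ⟨NNReal.sqrt C, fun δ _ u v w hu hv hw => ?_⟩
  -- Choosing extensions of norms below `a`, `b`, `d` gives all three conclusions; the first two do
  -- not depend on the bounds.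
  have key : ∀ a b d : ℝ≥0∞, restrictedNorm δ s (1 / 2) (pairing u) < a →
      restrictedNorm δ s (1 / 2) (pairing v) < b → restrictedNorm δ s (1 / 2) (pairing w) < d →
      ((∀ k₁ k₂ k₃ : ℤ, IntegrableOn (fun t : ℝ => u k₁ t * v k₂ t * w k₃ t) (Ioo (-δ) δ)) ∧
        ∀ k : ℤ, ∀ φ : 𝓢(ℝ, ℂ), IsTest δ φ →
          Summable fun q : nonresonant k => cubicTerm u v w φ q) ∧
      restrictedNorm δ s₁ (-(1 / 2) + ε) (cubicR u v w) ≤ NNReal.sqrt C * a * b * d := by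
    intro a b d ha hb hd
    obtain ⟨U, F, hU, hFa⟩ := exists_isExtension hu.1 ha
    obtain ⟨V, G, hV, hGb⟩ := exists_isExtension hv.1 hb
    obtain ⟨W, H, hW, hHd⟩ := exists_isExtension hw.1 hd
    have hest : sqNorm s₁ (-(1 / 2) + ε)
        (trilinear (fun p => ‖F p‖ₑ) (fun p => ‖G p‖ₑ) (fun p => ‖H p‖ₑ)) ≤
        C * (sqNorm s (1 / 2) (fun p => ‖F p‖ₑ) * sqNorm s (1 / 2) (fun p => ‖G p‖ₑ) *
          sqNorm s (1 / 2) (fun p => ‖H p‖ₑ)) :=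
      hC _ _ _ hU.measurable.enorm hV.measurable.enorm hW.measurable.enorm
    have hfin := hest.trans_lt (ENNReal.mul_lt_top ENNReal.coe_lt_top
      (ENNReal.mul_lt_top (ENNReal.mul_lt_top hU.finite hV.finite) hW.finite))
    obtain ⟨hsum, hle⟩ := hU.restrictedNorm_cubicR_le hV hW (by linarith) hfin
    refine ⟨⟨hU.integrableOn_mul_mul hV hW, hsum⟩, hle.trans ?_⟩
    have hsqrt : ((NNReal.sqrt C : ℝ≥0) : ℝ≥0∞) = (C : ℝ≥0∞) ^ (1 / 2 : ℝ) := by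
      rw [NNReal.sqrt_eq_rpow, ENNReal.coe_rpow_of_nonneg _ (by norm_num)]
    calc weightedL2Norm s₁ (-(1 / 2) + ε) (cubicFourier F G H)
        ≤ (C * (sqNorm s (1 / 2) (fun p => ‖F p‖ₑ) * sqNorm s (1 / 2) (fun p => ‖G p‖ₑ) *
          sqNorm s (1 / 2) (fun p => ‖H p‖ₑ))) ^ (1 / 2 : ℝ) := by
          rw [weightedL2Norm_eq]
          refine ENNReal.rpow_le_rpow (le_trans (lintegral_mono fun p => ?_) hest) (by norm_num)
          gcongr
          exact enorm_cubicFourier_le hU.measurable hV.measurable hW.measurable p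
      _ = NNReal.sqrt C * weightedL2Norm s (1 / 2) F * weightedL2Norm s (1 / 2) G *
          weightedL2Norm s (1 / 2) H := by
          simp only [weightedL2Norm_eq, hsqrt]
          simp only [ENNReal.mul_rpow_of_nonneg _ _ (show (0 : ℝ) ≤ 1 / 2 by norm_num), mul_assoc]
      _ ≤ NNReal.sqrt C * a * b * d := by gcongr
  obtain ⟨hint, hsum⟩ := (key ⊤ ⊤ ⊤ hu.2 hv.2 hw.2).1
  exact ⟨⟨hint, fun k _ => hsum k⟩, le_mul_mul_of_forall_lt ENNReal.coe_ne_top hu.2.ne hv.2.ne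
    hw.2.ne fun a b d ha hb hd => (key a b d ha hb hd).2⟩
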